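/- Let $S$ and $A$ be finite non-empty sets of states and actions of a Markov decision process with transition probabilities $p(s'\mid s,a)$ and random rewards $r(s,a)$ with mean $R(s,a)$ and $|r(s,a)|\le R_{max}<\infty$; given the past, the next state and the reward depend only on the current state and action. Let $\gamma\in(0,1)$ be the discount factor, and let $Q^*(s,a)$ be the largest expected discounted return $\mathbb E\big[\sum_{i\ge 0}\gamma^i r_i\big]$ over all policies $S\to A$, starting in state $s$ with action $a$. Consider (asynchronous) Q-learning with uniform experience replay with parameters $K,M\ge 1$ and initial values $Q_0:S\times A\to\mathbb R$: $K$ online iterations are followed by $M$ replay iterations, then again $K$ online ones, and so on. At an online iteration the learner in state $s$ chooses an action $a$ (in any way that depends on the past), receives a reward $r$, moves to a new state $s'$ according to the decision process, and the transition $(s,a,r,s')$ is stored in a memory of unbounded size. At a replay iteration a transition $(s,a,r,s')$ is drawn uniformly at random from the memory. In both cases the iteration updates only the value at $(s,a)$: $$Q_{t}(s,a)=(1-\alpha_t)\,Q_{t-1}(s,a)+\alpha_t\Big(r+\gamma\max_{a'}Q_{t-1}(s',a')\Big),\qquad \alpha_t=\frac1{n_t(s,a)},$$ where $n_t(s,a)$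 is the number of updates at $(s,a)$ up to and including iteration $t$ (online and replay iterations are both counted in $t$ and in $n_t$). Assume that for some $c\in(0,1)$, from any time on and any state at that time, every state-action pair is visited by an online iteration within $|S||A|/c$ iterations (online and replay), almost surely. Let $V_{max}=R_{max}/(1-\gamma)$ and $D_0=V_{max}+\max(\|Q_0\|_\infty,V_{max})$. Let $\epsilon_1>0$ and $\delta\in(0,1)$, and put $$X=\Big(\frac{3|S||A|}{c}\Big)^{\max\left\{1,\ \frac{2}{1-\gamma}\log\frac{D_0}{\epsilon_1}\right\}}\Big(\frac{|S||A|R_{max}^2\log(|S||A|/\delta)}{c(1-\gamma)^4\epsilon_1^2}+\log\frac{|S||A|}{c^3}\Big),$$ $$\ell=1+\log\frac1{1-\gamma}+\log\Big(1+\max\Big\{0,\log\frac{D_0}{\epsilon_1}\Big\}\Big)$$ (with the second element of the maximum in the exponent read as $0$, and likewise the logarithm in $\ell$, if $D_0=0$). Then there are absolute constants $C>0$ and $d\in\mathbb N$, which depend on none of the data above, such that for every real $T\ge C\,\ell^{d}X$ (that is, $T=\tilde\Omega(X)$), with probability at least $1-\delta$, $$\|Q_t-Q^*\|_\infty\le\epsilon_1\qquad\text{for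 all } t\ge T .$$ -/

import Mathlib

open MeasureTheory ProbabilityTheory

namespace ReplayQ

/-- A Markov decision process with state space `S` and action space `A`: `outcome s a` is the joint
law of (next state, reward) when action `a` is taken in state `s`. -/
structure MDP (S A : Type*) [MeasurableSpace S] where
  outcome : S → A → Measure (S × ℝ)
  isProb : ∀ s a, IsProbabilityMeasure (outcome s a)

namespace MDP

/-- The transition probability `p(s' | s, a)`. -/
noncomputable def transProb {S A : Type*} [MeasurableSpace S] (m : MDP S A)
    (s : S) (a : A) (s' : S) : ℝ :=
  (m.outcome s a).real {z | z.1 = s'}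

/-- The expected reward `R(s, a)`. -/
noncomputable def meanReward {S A : Type*} [MeasurableSpace S] (m : MDP S A)
    (s : S) (a : A) : ℝ :=
  ∫ z, z.2 ∂(m.outcome s a)

/-- The expected reward collected at step `i` when the process starts in the state-action pair `x`
and the actions at all the steps after the initial one follow the policy `π : S → A`. -/
noncomputable def stepReward {S A : Type*} [MeasurableSpace S] [Fintype S] (m : MDP S A)
    (π : S → A) : ℕ → S × A → ℝ
  | 0, x => m.meanReward x.1 x.2
  | i + 1, x => ∑ s' : S, m.transProb x.1 x.2 s' * stepReward m π i (s', π s')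

/-- The expected discounted return of the policy `π` from the state-action pair `x`. -/
noncomputable def policyQ {S A : Type*} [MeasurableSpace S] [Fintype S] (m : MDP S A)
    (γ : ℝ) (π : S → A) (x : S × A) : ℝ :=
  ∑' i : ℕ, γ ^ i * m.stepReward π i x

/-- The optimal Q-function: the best expected discounted return over all policies. -/
noncomputable def optQ {S A : Type*} [MeasurableSpace S] [Fintype S] (m : MDP S A)
    (γ : ℝ) (x : S × A) : ℝ :=
  ⨆ π : S → A, m.policyQ γ π x

/-- All the rewards are bounded by `Rmax` in absolute value. -/
def RewardBounded {S A : Type*} [MeasurableSpace S] (m : MDP S A) (Rmax : ℝ) : Prop :=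
  ∀ s a, ∀ᵐ z ∂(m.outcome s a), |z.2| ≤ Rmax

end MDP

/-- Iteration `t` (counted from `0`) is an online one, as opposed to a replay one: `K` online
iterations are followed by `M` replay iterations, and so on periodically. -/
def IsOnline (K M t : ℕ) : Prop := t % (K + M) < K

instance (K M : ℕ) : DecidablePred (IsOnline K M) :=
  fun t => inferInstanceAs (Decidable (t % (K + M) < K))

/-- The content of the memory buffer at the beginning of iteration `t`: every earlier online
iteration has stored its transition. Transitions are named by the iteration that stored them. -/
def memory (K M t : ℕ) : Finset ℕ := (Finset.range t).filter (IsOnline K M)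

/-- The random variables in a run of the algorithm on a sample space `Ω`. -/
structure Run (S A Ω : Type*) where
  /-- The state of the environment at the beginning of iteration `t`. -/
  state : ℕ → Ω → S
  /-- The action taken at iteration `t`, if that is an online iteration. -/
  action : ℕ → Ω → A
  /-- The reward received at iteration `t`, if that is an online iteration. -/
  reward : ℕ → Ω → ℝ
  /-- The name of the transition drawn from the memory buffer at iteration `t`, if that is a replay
  iteration. -/
  replayed : ℕ → Ω → ℕ

namespace Run

/-- The name of the transition `(state j, action j, reward j, state (j + 1))` that iteration `t`
uses to update the Q-values. -/
def source {S A Ω : Type*} (run : Run S A Ω) (K M t : ℕ) (ω : Ω) : ℕ :=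
  if IsOnline K M t then t else run.replayed t ω

/-- The unique state-action pair whose Q-value is updated at iteration `t`. -/
def updatedPair {S A Ω : Type*} (run : Run S A Ω) (K M t : ℕ) (ω : Ω) : S × A :=
  (run.state (run.source K M t ω) ω, run.action (run.source K M t ω) ω)

open Classical in
/-- The number of updates of the Q-value at `x` up to iteration `t`, including iteration `t`. -/
noncomputable def updateCount {S A Ω : Type*} (run : Run S A Ω) (K M t : ℕ) (ω : Ω)
    (x : S × A) : ℕ :=
  ((Finset.range (t + 1)).filter (fun i => run.updatedPair K M i ω = x)).card

open Classical in
/-- The Q-values after `t` iterations, with initial values `Q₀`: iteration `t` uses the learning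
rate `1 / n` at the pair that it updates, and `0` elsewhere. -/
noncomputable def qValue {S A Ω : Type*} (run : Run S A Ω) (K M : ℕ) (γ : ℝ)
    (Q₀ : S × A → ℝ) : ℕ → Ω → S × A → ℝ
  | 0, _ => Q₀
  | t + 1, ω => fun x =>
      let j := run.source K M t ω
      let α : ℝ := if run.updatedPair K M t ω = x then 1 / (run.updateCount K M t ω x : ℝ) else 0
      (1 - α) * qValue run K M γ Q₀ t ω x
        + α * (run.reward j ω + γ * ⨆ a' : A, qValue run K M γ Q₀ t ω (run.state (j + 1) ω, a'))

/-- `run` is a run of Q-learning with uniform experience replay on the MDP `m`. The σ-algebra `ℱ t`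
is the information available just before the random outcome of iteration `t` is drawn. It contains
the action of iteration `t`, which may have been chosen in any (also randomized) way from the
past. -/
structure IsReplayQLearning {S A Ω : Type*} [MeasurableSpace S] [MeasurableSpace A]
    {mΩ : MeasurableSpace Ω} (m : MDP S A) (K M : ℕ) (μ : Measure Ω) (ℱ : Filtration ℕ mΩ)
    (run : Run S A Ω) : Prop where
  state_measurable : ∀ t, Measurable[ℱ t] (run.state t)
  action_measurable : ∀ t, Measurable[ℱ t] (run.action t)
  reward_measurable : ∀ t, Measurable[ℱ (t + 1)] (run.reward t)
  replayed_measurable : ∀ t, Measurable[ℱ (t + 1)] (run.replayed t)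
  /-- At an online iteration the next state and the reward are drawn from the MDP. -/
  online_law : ∀ t, IsOnline K M t → ∀ B : Set (S × ℝ), MeasurableSet B →
    μ⟦(fun ω => (run.state (t + 1) ω, run.reward t ω)) ⁻¹' B | ℱ t⟧
      =ᵐ[μ] fun ω => (m.outcome (run.state t ω) (run.action t ω)).real B
  /-- At a replay iteration a transition is drawn uniformly from the memory buffer. -/
  replay_law : ∀ t, ¬ IsOnline K M t → ∀ i ∈ memory K M t,
    μ⟦run.replayed t ⁻¹' {i} | ℱ t⟧ =ᵐ[μ] fun _ => 1 / ((memory K M t).card : ℝ)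
  /-- Replay does not move the environment. -/
  replay_state : ∀ t, ¬ IsOnline K M t → run.state (t + 1) = run.state t

/-- From any time `t` on, whatever the current state, every state-action pair is visited (by an
online iteration) within `|S| |A| / c` iterations, counting online and replay iterations. -/
def Covers {S A Ω : Type*} [Fintype S] [Fintype A] {mΩ : MeasurableSpace Ω}
    (run : Run S A Ω) (K M : ℕ) (μ : Measure Ω) (c : ℝ) : Prop :=
  ∀ᵐ ω ∂μ, ∀ t : ℕ, ∀ s : S, ∀ a : A, ∃ i : ℕ, t ≤ i ∧
    (i : ℝ) + 1 ≤ t + (Fintype.card S * Fintype.card A : ℝ) / c ∧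
    IsOnline K M i ∧ run.state i ω = s ∧ run.action i ω = a

end Run

/-- `V_max = R_max / (1 - γ)`. -/
noncomputable def vMax (Rmax γ : ℝ) : ℝ := Rmax / (1 - γ)

/-- `D₀ = V_max + max (‖Q₀‖_∞, V_max)`. -/
noncomputable def initDist {S A : Type*} [Fintype S] [Fintype A] (Rmax γ : ℝ)
    (Q₀ : S × A → ℝ) : ℝ :=
  vMax Rmax γ + max ‖Q₀‖ (vMax Rmax γ)

/-- The explicit part of the lower bound on the time, where `n = |S| |A|`. -/
noncomputable def timeBound (n Rmax γ D₀ c δ ε : ℝ) : ℝ :=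
  (3 * n / c) ^ (max 1 (2 / (1 - γ) * Real.log (D₀ / ε))) *
    (n * Rmax ^ 2 * Real.log (n / δ) / (c * (1 - γ) ^ 4 * ε ^ 2) + Real.log (n / c ^ 3))

/-- The quantity, logarithmic in `1 / (1 - γ)` and doubly logarithmic in `D₀ / ε`, whose powers the
soft order notation hides. -/
noncomputable def softFactor (γ D₀ ε : ℝ) : ℝ :=
  1 + Real.log (1 / (1 - γ)) + Real.log (1 + max 0 (Real.log (D₀ / ε)))

end ReplayQ

/-!
# Convergence rate of Q-learning with uniform experience replay

With the learning rate `1 / n` the estimate at a pair `x` is the plain average of all its targets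
(`card_mul_qValue`): the first update erases the initial value. Splitting every target at the
optimal values, the error at `x` is at most `γ` times the average of the sup-norm errors at the
times of the updates at `x`, plus the average of the sampling errors `r + γ V*(s') - Q*(s, a)`
(`abs_qValue_sub_le`). The sampling errors involve the fixed function `V*` and not the current
estimates, so that no uniform concentration over value functions is needed, although the replayed
transitions are correlated with the estimates.

*Sampling errors.* The errors of the stored transitions at `x` form a martingale. A replayed
transition is a uniform draw from the memory, so its error, centred at the empirical mean over the
stored transitions at `x`, is a martingale difference too. For each of the two an exponential
supermartingale, whose clock counts the visits (respectively the updates) at `x`, is controlled at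
all times simultaneously by Ville's inequality (`measure_exists_le_sum_le`). After `N` visits the
empirical mean is of order `w + B / N`, and summing this bias over the replay iterations costs only
a logarithm. In the end the average of the sampling errors stays below the level `w` from some
explicit number of updates on (`abs_sum_tdNoise_le`).

*Contraction.* Every pair has at least `t / L` updates before time `t`, where `L` is the integer
part of `|S| |A| / c`, and in the worst case these are the earliest ones, whose errors are largest.
Hence the error at time `t` is bounded by `γ` times the average of an antitone majorant over the
first `t / L` times, plus `w`. For `w = (1 - γ) F` the excess over the level `F` obeys the recursion
without noise, and it shrinks by the factor `(1 + 2 γ) / 3` whenever the time grows by the factor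
`3 L` (`phase_contraction`). By Bernoulli's inequality the noise level `F = ζ ε` only inflates
`u = log (D₀ / ε) / (1 - γ)` to `u / (1 - ζ)` (`phases_suffice`).

*Comparison with the time bound.* The exponent `2 u` of `3 |S| |A| / c` leaves room over the number
of phases that are needed, except for `u` just below `1`, where a single phase has to do and `ζ` is
taken of order `1 / log (3 |S| |A| / c)` (`exists_phases`). Only the factor `log (1 / (1 - γ))` of
the logarithm of the relative noise level is not absorbed, so the first power of the soft factor is
enough. For a single state-action pair and `δ` close to `1`, where `log (|S| |A| / δ)` degenerates,
the noise is smaller by the factor `1 - γ` and all iterations update the same pair, which makes the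
remaining term of the bound sufficient (`le_measure_of_subsingleton`).
-/

namespace ReplayQ

open scoped ENNReal

/-! ### Averages of antitone sequences -/

theorem sum_le_sum_range_card {f : ℕ → ℝ} (hf : Antitone f) (U : Finset ℕ) :
    ∑ i ∈ U, f i ≤ ∑ i ∈ Finset.range U.card, f i := by
  induction U using Finset.induction_on_max with
  | empty => simp
  | insert a U ha ih =>
    have hnot : a ∉ U := fun h => lt_irrefl _ (ha a h)
    have hcard : U.card ≤ a := by
      have : U ⊆ Finset.range a := fun x hx => Finset.mem_range.2 (ha x hx)
      simpa using Finset.card_le_card this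
    rw [Finset.sum_insert hnot, Finset.card_insert_of_notMem hnot, Finset.sum_range_succ, add_comm]
    exact add_le_add ih (hf hcard)

theorem mul_sum_range_le {f : ℕ → ℝ} (hf : Antitone f) {m n : ℕ} (hmn : m ≤ n) :
    m * ∑ i ∈ Finset.range n, f i ≤ n * ∑ i ∈ Finset.range m, f i := by
  induction n, hmn using Nat.le_induction with
  | base => exact le_rfl
  | succ n hmn ih =>
    have h : (m : ℝ) * f n ≤ ∑ i ∈ Finset.range m, f i := by
      have := Finset.card_nsmul_le_sum (Finset.range m) f (f n)
        (fun i hi => hf ((Finset.mem_range.1 hi).le.trans hmn))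
      simpa using this
    rw [Finset.sum_range_succ]
    push_cast
    linarith

/-- The average of an antitone sequence over any set of at least `m` indices is at most its average
over the first `m` indices. -/
theorem sum_div_card_le {f : ℕ → ℝ} (hf : Antitone f) {m : ℕ} (hm : 1 ≤ m) {U : Finset ℕ}
    (hU : m ≤ U.card) :
    (∑ i ∈ U, f i) / U.card ≤ (∑ i ∈ Finset.range m, f i) / m := by
  have hm' : (0 : ℝ) < m := by exact_mod_cast hm
  have hU' : (0 : ℝ) < U.card := by exact_mod_cast hm.trans hU
  rw [div_le_div_iff₀ hU' hm']
  have h1 := sum_le_sum_range_card hf U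
  have h2 := mul_sum_range_le hf hU
  nlinarith

/-! ### Contraction of the error along geometric phases -/

/-- If every `e t` with `t ≥ T₁` is at most `γ` times an average of an antitone majorant of `e` over
the first `t / ℓ` times, up to an additive error that keeps the level `F` invariant, then the
excess of `e` over `F` shrinks by the factor `(1 + (a - 1) γ) / a` whenever the time grows by the
factor `a ℓ`. -/
theorem phase_contraction {e : ℕ → ℝ} {γ F D : ℝ} {a ℓ T₁ : ℕ} (hγ : 0 ≤ γ) (ha : 1 ≤ a)
    (hℓ : 1 ≤ ℓ) (hT₁ : ℓ ≤ T₁) (hFD : F ≤ D) (hD : ∀ t, e t ≤ D)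
    (hrec : ∀ t, T₁ ≤ t → ∀ E : ℕ → ℝ, Antitone E → (∀ i, e i ≤ E i) → ∀ m : ℕ, 1 ≤ m →
      m * ℓ ≤ t → e t ≤ γ * ((∑ i ∈ Finset.range m, E i) / m) + (1 - γ) * F) (k : ℕ) :
    ∀ t, T₁ * (a * ℓ) ^ k ≤ t → e t ≤ F + γ * (D - F) * ((1 + (a - 1) * γ) / a) ^ k := by
  have ha' : (1 : ℝ) ≤ a := by exact_mod_cast ha
  have hℓ' : (1 : ℝ) ≤ ℓ := by exact_mod_cast hℓ
  -- The majorant built in the previous phases, averaged up to the current time, is carried along.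
  suffices h : (∀ t, T₁ * (a * ℓ) ^ k ≤ t → e t ≤ F + γ * (D - F) * ((1 + (a - 1) * γ) / a) ^ k) ∧
      ∃ E : ℕ → ℝ, Antitone E ∧ (∀ i, e i ≤ E i) ∧
        γ * ∑ i ∈ Finset.range (T₁ * (a * ℓ) ^ k), (E i - F)
          ≤ (T₁ * (a * ℓ) ^ k : ℕ) * (γ * (D - F) * ((1 + (a - 1) * γ) / a) ^ k) from h.1
  induction k with
  | zero =>
    constructor
    · intro t ht
      have := hrec t (by simpa using ht) (fun _ => D) antitone_const hD 1 le_rfl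
        (by simp at ht; omega)
      simp at this ⊢
      linarith
    · refine ⟨fun _ => D, antitone_const, hD, le_of_eq ?_⟩
      simp
      ring
  | succ k ih =>
    obtain ⟨ih1, E, hE, hEe, hEs⟩ := ih
    set T := T₁ * (a * ℓ) ^ k with hTdef
    set d := γ * (D - F) * ((1 + (a - 1) * γ) / a) ^ k with hd
    have hd0 : 0 ≤ d := by
      have h1 : 0 ≤ (1 + ((a : ℝ) - 1) * γ) / a := by
        have : 0 ≤ ((a : ℝ) - 1) * γ := mul_nonneg (by linarith) hγ
        positivity
      have : 0 ≤ D - F := by linarith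
      positivity
    have hTnext : T₁ * (a * ℓ) ^ (k + 1) = a * ℓ * T := by rw [hTdef, pow_succ]; ring
    have hdnext : γ * (D - F) * ((1 + (a - 1) * γ) / a) ^ (k + 1) = d * ((1 + (a - 1) * γ) / a) := by
      rw [hd, pow_succ]; ring
    rw [hTnext, hdnext]
    have hTpos : 1 ≤ T := Nat.mul_pos (by omega) (pow_pos (Nat.mul_pos ha hℓ) _)
    have hTpos' : (1 : ℝ) ≤ T := by exact_mod_cast hTpos
    set E' : ℕ → ℝ := fun i => if i < T then E i else min (E i) (F + d) with hE'
    have hE'anti : Antitone E' := by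
      intro i j hij
      simp only [hE']
      split_ifs with h1 h2 h2
      · exact hE hij
      · omega
      · exact (min_le_left _ _).trans (hE hij)
      · exact min_le_min (hE hij) le_rfl
    have hE'e : ∀ i, e i ≤ E' i := by
      intro i
      simp only [hE']
      split_ifs with h
      · exact hEe i
      · exact le_min (hEe i) (ih1 i (not_lt.1 h))
    have hTa : T ≤ a * T := Nat.le_mul_of_pos_left _ ha
    have hsum : γ * ∑ i ∈ Finset.range (a * T), (E' i - F)
        ≤ (a * T : ℕ) * (d * ((1 + (a - 1) * γ) / a)) := by
      rw [← Finset.sum_range_add_sum_Ico _ hTa]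
      have h1 : ∑ i ∈ Finset.range T, (E' i - F) = ∑ i ∈ Finset.range T, (E i - F) := by
        refine Finset.sum_congr rfl fun i hi => ?_
        simp [hE', Finset.mem_range.1 hi]
      have h2 : ∑ i ∈ Finset.Ico T (a * T), (E' i - F) ≤ (a * T - T) * d := by
        have := Finset.sum_le_card_nsmul (Finset.Ico T (a * T)) (fun i => E' i - F) d
          (fun i hi => by
            have : ¬ i < T := not_lt.2 (Finset.mem_Ico.1 hi).1
            simp only [hE', this, if_false]
            linarith [min_le_right (E i) (F + d)])
        simpa [Nat.cast_sub hTa] using this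
      rw [h1, mul_add]
      have h3 := mul_le_mul_of_nonneg_left h2 hγ
      have h4 : ((a * T : ℕ) : ℝ) * (d * ((1 + (a - 1) * γ) / a)) = T * d + γ * ((a * T - T) * d) := by
        push_cast
        field_simp
      rw [h4]
      linarith
    have hanti2 : Antitone fun i => E' i - F := fun i j hij => sub_le_sub_right (hE'anti hij) _
    have haT : 1 ≤ a * T := Nat.mul_pos ha hTpos
    have haT' : (0 : ℝ) < (a * T : ℕ) := by exact_mod_cast haT
    refine ⟨fun t ht => ?_, E', hE'anti, hE'e, ?_⟩
    · have hT₁t : T₁ ≤ t := by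
        refine le_trans ?_ ht
        calc T₁ ≤ T := Nat.le_mul_of_pos_right _ (pow_pos (Nat.mul_pos ha hℓ) _)
          _ ≤ a * ℓ * T := Nat.le_mul_of_pos_left _ (Nat.mul_pos ha hℓ)
      have h := hrec t hT₁t E' hE'anti hE'e (a * T) haT (by rw [mul_right_comm]; exact ht)
      have h5 : (∑ i ∈ Finset.range (a * T), E' i)
          = ∑ i ∈ Finset.range (a * T), (E' i - F) + (a * T : ℕ) * F := by
        simp
      rw [h5, add_div, mul_add, mul_div_cancel_left₀ _ haT'.ne', ← mul_div_assoc] at h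
      have h6 : (γ * ∑ i ∈ Finset.range (a * T), (E' i - F)) / (a * T : ℕ)
          ≤ d * ((1 + (a - 1) * γ) / a) := by
        rw [div_le_iff₀ haT']
        linarith
      linarith
    · have hle : a * T ≤ a * ℓ * T := by
        rw [mul_right_comm]
        exact Nat.le_mul_of_pos_right _ hℓ
      have h := mul_le_mul_of_nonneg_left (mul_sum_range_le hanti2 hle) hγ
      have h7 : ((a * T : ℕ) : ℝ) * (γ * ∑ i ∈ Finset.range (a * ℓ * T), (E' i - F))
          ≤ (a * T : ℕ) * ((a * ℓ * T : ℕ) * (d * ((1 + (a - 1) * γ) / a))) := by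
        have := mul_le_mul_of_nonneg_left hsum (Nat.cast_nonneg (α := ℝ) (a * ℓ * T))
        linarith
      exact le_of_mul_le_mul_left h7 haT'

/-- After the first phase and `k` further ones the error is at most `ε`, if the number of phases
beats the logarithm of `D / ε`, inflated by `1 / (1 - ζ)` for the noise level `ζ * ε`. -/
theorem phases_suffice {γ ε D ζ u : ℝ} {a k : ℕ} (hγ : 0 < γ) (hγ1 : γ < 1) (ha : 1 ≤ a)
    (hε : 0 < ε) (hD : ε ≤ D) (hζ : 0 < ζ) (hζ1 : ζ < 1)
    (hu : u = Real.log (D / ε) / (1 - γ)) (hk : u / (1 - ζ) ≤ 1 + k * ((a - 1) / a : ℝ)) :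
    ζ * ε + γ * (D - ζ * ε) * ((1 + (a - 1) * γ) / a) ^ k ≤ ε := by
  have ha' : (1 : ℝ) ≤ a := by exact_mod_cast ha
  have hD0 : 0 < D := hε.trans_le hD
  have hq : (1 + ((a : ℝ) - 1) * γ) / a ≤ Real.exp (-((1 - γ) * ((a - 1) / a))) := by
    refine le_trans (le_of_eq ?_) (Real.add_one_le_exp _)
    field_simp
    ring
  have hq0 : 0 ≤ (1 + ((a : ℝ) - 1) * γ) / a := by
    have : 0 ≤ ((a : ℝ) - 1) * γ := mul_nonneg (by linarith) hγ.le
    positivity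
  have hγe : γ ≤ Real.exp (-(1 - γ)) := by
    refine le_trans (le_of_eq ?_) (Real.add_one_le_exp _); ring
  have hprod : γ * ((1 + ((a : ℝ) - 1) * γ) / a) ^ k
      ≤ Real.exp (-((1 - γ) * (u / (1 - ζ)))) := by
    calc γ * ((1 + ((a : ℝ) - 1) * γ) / a) ^ k
        ≤ Real.exp (-(1 - γ)) * Real.exp (-((1 - γ) * ((a - 1) / a))) ^ k :=
          mul_le_mul hγe (pow_le_pow_left₀ hq0 hq k) (pow_nonneg hq0 k) (Real.exp_pos _).le
      _ = Real.exp (-((1 - γ) * (1 + k * ((a - 1) / a : ℝ)))) := by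
          rw [← Real.exp_nat_mul, ← Real.exp_add]; ring_nf
      _ ≤ _ := by
          apply Real.exp_le_exp.2
          have := mul_le_mul_of_nonneg_left hk (sub_pos.2 hγ1).le
          linarith
  have hval : Real.exp (-((1 - γ) * (u / (1 - ζ)))) = ((D / ε) ^ (1 / (1 - ζ)))⁻¹ := by
    rw [Real.rpow_def_of_pos (by positivity), ← Real.exp_neg, hu]
    congr 1
    have : 1 - γ ≠ 0 := by linarith
    field_simp
  -- Bernoulli: `(D - ζ ε) / (ε - ζ ε) ≤ (D / ε) ^ (1 / (1 - ζ))`.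
  have hbern : (D - ζ * ε) ≤ (ε - ζ * ε) * (D / ε) ^ (1 / (1 - ζ)) := by
    have hs : -1 ≤ D / ε - 1 := by have : 0 < D / ε := by positivity
                                   linarith
    have hp : 1 ≤ 1 / (1 - ζ) := by rw [le_div_iff₀ (by linarith)]; linarith
    have h := one_add_mul_self_le_rpow_one_add hs hp
    rw [show 1 + (D / ε - 1) = D / ε by ring] at h
    have hpos : 0 < ε - ζ * ε := by nlinarith
    refine le_trans (le_of_eq ?_) (mul_le_mul_of_nonneg_left h hpos.le)
    have : 1 - ζ ≠ 0 := by linarith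
    field_simp
    ring
  have hR : 0 < (D / ε) ^ (1 / (1 - ζ)) := by positivity
  rw [hval] at hprod
  have hDz : 0 ≤ D - ζ * ε := by nlinarith
  have h1 : (D - ζ * ε) * (γ * ((1 + ((a : ℝ) - 1) * γ) / a) ^ k) ≤ ε - ζ * ε := by
    refine (mul_le_mul_of_nonneg_left hprod hDz).trans ?_
    rw [← div_eq_mul_inv, div_le_iff₀ hR]
    exact hbern
  linarith

/-! ### The bias of the replayed transitions -/

/-- `2 B / (z + N)` with `z = B / σ` dominates `min σ (B / N)`, the size of the bias after `N` visits,
so this sum bounds the accumulated bias without a case distinction. -/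
theorem sum_inv_add_le_log {z : ℝ} (hz : 1 ≤ z) (m : ℕ) :
    ∑ j ∈ Finset.range m, 1 / (z + j) ≤ 2 * Real.log (1 + m / z) := by
  have hz0 : 0 < z := by linarith
  have key : ∀ j : ℕ, 1 / (z + j) ≤ 2 * (Real.log (z + (j + 1 : ℕ)) - Real.log (z + j)) := by
    intro j
    have hj : (0 : ℝ) ≤ j := Nat.cast_nonneg j
    have h1 : 0 < z + j := by linarith
    have h2 : 0 < z + (j + 1 : ℕ) := by push_cast; linarith
    rw [← Real.log_div h2.ne' h1.ne']
    have h3 := Real.one_sub_inv_le_log_of_pos (div_pos h2 h1)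
    have h4 : 1 / (z + j) ≤ 2 * (1 - ((z + (j + 1 : ℕ)) / (z + j))⁻¹) := by
      rw [inv_div]
      push_cast at h2 ⊢
      rw [one_sub_div h2.ne', ← mul_div_assoc, div_le_div_iff₀ h1 h2]
      nlinarith
    linarith
  calc ∑ j ∈ Finset.range m, 1 / (z + j)
      ≤ ∑ j ∈ Finset.range m, 2 * (Real.log (z + (j + 1 : ℕ)) - Real.log (z + j)) :=
        Finset.sum_le_sum fun j _ => key j
    _ = 2 * (Real.log (z + m) - Real.log z) := by
        rw [← Finset.mul_sum, Finset.sum_range_sub (fun j : ℕ => Real.log (z + j))]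
        simp
    _ = 2 * Real.log (1 + m / z) := by
        rw [← Real.log_div (by positivity) hz0.ne', add_div, div_self hz0.ne']

/-- With `q` proportional to the number of updates and `s = σ / w`, the logarithm of the accumulated
bias is beaten by the number of updates. -/
theorem eight_mul_log_le {q s : ℝ} (hs : 1 ≤ s) (hq : 128 * (1 + Real.log s) ≤ q) :
    8 * Real.log (1 + q * s) ≤ q := by
  have hl : 0 ≤ Real.log s := Real.log_nonneg hs
  have hq0 : 128 ≤ q := by linarith
  have h1 : Real.log (1 + q * s) ≤ Real.log ((1 + q) * s) :=
    Real.log_le_log (by positivity) (by nlinarith)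
  rw [Real.log_mul (by positivity) (by positivity)] at h1
  have h2 : Real.log (1 + q) ≤ (1 + q) / 32 - 1 + 5 * Real.log 2 := by
    have h := Real.log_le_sub_one_of_pos (show 0 < (1 + q) / 32 by positivity)
    rw [Real.log_div (by positivity) (by norm_num), show (32 : ℝ) = 2 ^ 5 by norm_num,
      Real.log_pow] at h
    push_cast at h
    linarith
  have h3 := Real.log_two_lt_d9
  linarith

/-! ### The Bellman optimality equation -/

theorem abs_iSup_sub_iSup_le {A : Type*} [Finite A] [Nonempty A] {f g : A → ℝ} {C : ℝ}
    (h : ∀ a, |f a - g a| ≤ C) : |(⨆ a, f a) - ⨆ a, g a| ≤ C := by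
  have hf : BddAbove (Set.range f) := Set.Finite.bddAbove (Set.finite_range f)
  have hg : BddAbove (Set.range g) := Set.Finite.bddAbove (Set.finite_range g)
  rw [abs_le]
  constructor
  · have : ⨆ a, g a ≤ (⨆ a, f a) + C := ciSup_le fun a => by
      have h1 := le_ciSup hf a
      have h2 := (abs_le.1 (h a)).1
      linarith
    linarith
  · have : ⨆ a, f a ≤ (⨆ a, g a) + C := ciSup_le fun a => by
      have h1 := le_ciSup hg a
      have h2 := (abs_le.1 (h a)).2
      linarith
    linarith

theorem abs_iSup_le {A : Type*} [Finite A] [Nonempty A] {f : A → ℝ} {C : ℝ}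
    (h : ∀ a, |f a| ≤ C) : |⨆ a, f a| ≤ C := by
  have := abs_iSup_sub_iSup_le (f := f) (g := fun _ => 0) (C := C) (by simpa using h)
  simpa using this

namespace MDP

variable {S A : Type*} [MeasurableSpace S] {m : MDP S A} {Rmax γ : ℝ}

theorem integrable_reward (hR : m.RewardBounded Rmax) (s : S) (a : A) :
    Integrable (fun z : S × ℝ => z.2) (m.outcome s a) := by
  have := m.isProb s a
  exact Integrable.of_bound measurable_snd.aestronglyMeasurable Rmax
    (by simpa [Real.norm_eq_abs] using hR s a)

theorem abs_meanReward_le (hR : m.RewardBounded Rmax) (s : S) (a : A) :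
    |m.meanReward s a| ≤ Rmax := by
  have := m.isProb s a
  have h := norm_integral_le_of_norm_le_const (μ := m.outcome s a) (f := fun z : S × ℝ => z.2)
    (C := Rmax) (by simpa [Real.norm_eq_abs] using hR s a)
  simpa [meanReward, Real.norm_eq_abs] using h

theorem RewardBounded.nonneg [Nonempty S] [Nonempty A] (hR : m.RewardBounded Rmax) :
    0 ≤ Rmax :=
  (abs_nonneg _).trans (abs_meanReward_le hR (Classical.arbitrary S) (Classical.arbitrary A))

theorem transProb_nonneg (s : S) (a : A) (s' : S) : 0 ≤ m.transProb s a s' :=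
  measureReal_nonneg

variable [Fintype S]

theorem sum_transProb_mul [DiscreteMeasurableSpace S] (s : S) (a : A) (v : S → ℝ) :
    ∑ s', m.transProb s a s' * v s' = ∫ z, v z.1 ∂(m.outcome s a) := by
  have := m.isProb s a
  have hmap := integral_map (μ := m.outcome s a) (φ := Prod.fst) (f := v) measurable_fst.aemeasurable
    (measurable_of_finite v).aestronglyMeasurable
  have : IsProbabilityMeasure (Measure.map Prod.fst (m.outcome s a)) :=
    Measure.isProbabilityMeasure_map measurable_fst.aemeasurable
  rw [← hmap, integral_fintype .of_finite]
  refine Finset.sum_congr rfl fun s' _ => ?_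
  rw [map_measureReal_apply measurable_fst (measurableSet_singleton _), smul_eq_mul]
  rfl

theorem sum_transProb [DiscreteMeasurableSpace S] (s : S) (a : A) :
    ∑ s', m.transProb s a s' = 1 := by
  have := m.isProb s a
  simpa using sum_transProb_mul (m := m) s a (fun _ => 1)

theorem abs_sum_transProb_mul_le [DiscreteMeasurableSpace S] (s : S) (a : A) {v : S → ℝ} {C : ℝ}
    (hv : ∀ s', |v s'| ≤ C) : |∑ s', m.transProb s a s' * v s'| ≤ C := by
  calc |∑ s', m.transProb s a s' * v s'| ≤ ∑ s', |m.transProb s a s' * v s'| :=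
        Finset.abs_sum_le_sum_abs _ _
    _ ≤ ∑ s', m.transProb s a s' * C := by
        refine Finset.sum_le_sum fun s' _ => ?_
        rw [abs_mul, abs_of_nonneg (transProb_nonneg s a s')]
        exact mul_le_mul_of_nonneg_left (hv s') (transProb_nonneg s a s')
    _ = C := by rw [← Finset.sum_mul, sum_transProb, one_mul]

theorem abs_stepReward_le [DiscreteMeasurableSpace S] (hR : m.RewardBounded Rmax) (π : S → A)
    (i : ℕ) (x : S × A) : |m.stepReward π i x| ≤ Rmax := by
  induction i generalizing x with
  | zero => exact abs_meanReward_le hR _ _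
  | succ i ih => exact abs_sum_transProb_mul_le _ _ fun s' => ih _

theorem summable_stepReward [DiscreteMeasurableSpace S] (hR : m.RewardBounded Rmax) (hγ : 0 ≤ γ)
    (hγ1 : γ < 1) (π : S → A) (x : S × A) : Summable fun i : ℕ => γ ^ i * m.stepReward π i x := by
  refine Summable.of_norm_bounded ((summable_geometric_of_lt_one hγ hγ1).mul_right Rmax) fun i => ?_
  rw [norm_mul, norm_pow, Real.norm_of_nonneg hγ]
  exact mul_le_mul_of_nonneg_left (abs_stepReward_le hR π i x) (pow_nonneg hγ i)

theorem policyQ_eq [DiscreteMeasurableSpace S] (hR : m.RewardBounded Rmax) (hγ : 0 ≤ γ)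
    (hγ1 : γ < 1) (π : S → A) (x : S × A) :
    m.policyQ γ π x = m.meanReward x.1 x.2
      + γ * ∑ s', m.transProb x.1 x.2 s' * m.policyQ γ π (s', π s') := by
  unfold policyQ
  rw [(summable_stepReward hR hγ hγ1 π x).tsum_eq_zero_add]
  simp only [stepReward, pow_zero, one_mul, ← tsum_mul_left]
  congr 1
  rw [← Summable.tsum_finsetSum fun s' _ =>
    ((summable_stepReward hR hγ hγ1 π (s', π s')).mul_left _), ← tsum_mul_left]
  refine tsum_congr fun i => ?_
  rw [Finset.mul_sum, Finset.mul_sum]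
  refine Finset.sum_congr rfl fun s' _ => ?_
  ring

variable [Fintype A]

/-- The Bellman optimality operator. -/
noncomputable def bellman (m : MDP S A) (γ : ℝ) (q : S × A → ℝ) (x : S × A) : ℝ :=
  m.meanReward x.1 x.2 + γ * ∑ s', m.transProb x.1 x.2 s' * ⨆ a', q (s', a')

theorem exists_bellman_fixedPoint [DiscreteMeasurableSpace S] [Nonempty A] (hγ : 0 ≤ γ)
    (hγ1 : γ < 1) : ∃ q, m.bellman γ q = q := by
  have hc : ContractingWith ⟨γ, hγ⟩ (m.bellman γ) := by
    refine ⟨by exact_mod_cast hγ1, LipschitzWith.of_dist_le_mul fun q q' => ?_⟩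
    refine (dist_pi_le_iff (by positivity)).2 fun x => ?_
    rw [Real.dist_eq]
    have h : m.bellman γ q x - m.bellman γ q' x
        = γ * ∑ s', m.transProb x.1 x.2 s' * ((⨆ a', q (s', a')) - ⨆ a', q' (s', a')) := by
      simp only [bellman, mul_sub, Finset.sum_sub_distrib]
      ring
    rw [h, abs_mul, abs_of_nonneg hγ]
    refine mul_le_mul_of_nonneg_left (abs_sum_transProb_mul_le _ _ fun s' => ?_) hγ
    refine abs_iSup_sub_iSup_le fun a' => ?_
    rw [← Real.dist_eq]
    exact dist_le_pi_dist q q' (s', a')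
  exact ⟨_, hc.fixedPoint_isFixedPt⟩

/-- The fixed point of the optimality operator dominates every policy, and its greedy policy attains
it. -/
theorem bellman_optQ [DiscreteMeasurableSpace S] [Nonempty A] (hR : m.RewardBounded Rmax)
    (hγ : 0 ≤ γ) (hγ1 : γ < 1) : m.bellman γ (m.optQ γ) = m.optQ γ := by
  obtain ⟨q, hq⟩ := exists_bellman_fixedPoint (m := m) hγ hγ1
  suffices h : m.optQ γ = q by rw [h, hq]
  have hgreedy : ∀ s, ∃ a, q (s, a) = ⨆ a', q (s, a') := fun s =>
    exists_eq_ciSup_of_finite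
  choose π hπ using hgreedy
  have hqx : ∀ x, q x = m.meanReward x.1 x.2
      + γ * ∑ s', m.transProb x.1 x.2 s' * q (s', π s') := by
    intro x
    conv_lhs => rw [← hq]
    simp only [bellman, hπ]
  funext x
  have : Nonempty (S × A) := ⟨x⟩
  have hne : Nonempty (S → A) := ⟨π⟩
  refine le_antisymm ?_ ?_
  · refine ciSup_le fun π' => ?_
    obtain ⟨y, hy⟩ := exists_eq_ciSup_of_finite (f := fun y => m.policyQ γ π' y - q y)
    have hle : ∀ z, m.policyQ γ π' z - q z ≤ m.policyQ γ π' y - q y := fun z => by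
      rw [hy]
      exact le_ciSup (f := fun y => m.policyQ γ π' y - q y)
        (Set.Finite.bddAbove (Set.finite_range _)) z
    set d := m.policyQ γ π' y - q y with hd
    have hdle : d ≤ γ * d := by
      have h1 : d = γ * ∑ s', m.transProb y.1 y.2 s' *
          (m.policyQ γ π' (s', π' s') - ⨆ a', q (s', a')) := by
        have h2 := policyQ_eq hR hγ hγ1 π' y
        have h3 : q y = m.bellman γ q y := by rw [hq]
        rw [hd, h2, h3]
        simp only [bellman, mul_sub, Finset.sum_sub_distrib]
        ring
      have h4 : ∑ s', m.transProb y.1 y.2 s' * (m.policyQ γ π' (s', π' s') - ⨆ a', q (s', a'))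
          ≤ ∑ s', m.transProb y.1 y.2 s' * d := by
        refine Finset.sum_le_sum fun s' _ => mul_le_mul_of_nonneg_left ?_ (transProb_nonneg _ _ _)
        have h5 : q (s', π' s') ≤ ⨆ a', q (s', a') :=
          le_ciSup (f := fun a' => q (s', a')) (Set.Finite.bddAbove (Set.finite_range _)) (π' s')
        have := hle (s', π' s')
        linarith
      rw [← Finset.sum_mul, sum_transProb, one_mul] at h4
      exact h1.le.trans (mul_le_mul_of_nonneg_left h4 hγ)
    have hd0 : d ≤ 0 := by nlinarith
    have := hle x
    linarith
  · have hbdd : BddAbove (Set.range fun π' : S → A => m.policyQ γ π' x) :=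
      Set.Finite.bddAbove (Set.finite_range _)
    refine le_trans (le_of_eq ?_) (le_ciSup hbdd π)
    obtain ⟨y, hy⟩ := exists_eq_ciSup_of_finite (f := fun y => |m.policyQ γ π y - q y|)
    have hle : ∀ z, |m.policyQ γ π z - q z| ≤ |m.policyQ γ π y - q y| := fun z => by
      rw [hy]
      exact le_ciSup (f := fun y => |m.policyQ γ π y - q y|)
        (Set.Finite.bddAbove (Set.finite_range _)) z
    have hdle : |m.policyQ γ π y - q y| ≤ γ * |m.policyQ γ π y - q y| := by
      have h1 : m.policyQ γ π y - q y = γ * ∑ s', m.transProb y.1 y.2 s' *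
          (m.policyQ γ π (s', π s') - q (s', π s')) := by
        conv_lhs => rw [policyQ_eq hR hγ hγ1 π y, hqx y]
        simp only [mul_sub, Finset.sum_sub_distrib]
        ring
      have h2 := abs_sum_transProb_mul_le (m := m) y.1 y.2
        (v := fun s' => m.policyQ γ π (s', π s') - q (s', π s')) (fun s' => hle (s', π s'))
      calc |m.policyQ γ π y - q y| = _ := by rw [h1, abs_mul, abs_of_nonneg hγ]
        _ ≤ _ := mul_le_mul_of_nonneg_left h2 hγ
    have h0 : |m.policyQ γ π y - q y| ≤ 0 := by
      have := abs_nonneg (m.policyQ γ π y - q y)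
      nlinarith
    have := abs_nonpos_iff.1 ((hle x).trans h0)
    linarith

theorem abs_optQ_le [DiscreteMeasurableSpace S] [Nonempty A] (hR : m.RewardBounded Rmax)
    (hγ : 0 ≤ γ) (hγ1 : γ < 1) (x : S × A) : |m.optQ γ x| ≤ vMax Rmax γ := by
  have h : ∀ π : S → A, |m.policyQ γ π x| ≤ vMax Rmax γ := by
    intro π
    have h1 := tsum_of_norm_bounded ((hasSum_geometric_of_lt_one hγ hγ1).mul_right Rmax)
      (f := fun i : ℕ => γ ^ i * m.stepReward π i x) fun i => by
        rw [norm_mul, norm_pow, Real.norm_of_nonneg hγ]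
        exact mul_le_mul_of_nonneg_left (abs_stepReward_le hR π i x) (pow_nonneg hγ i)
    rw [Real.norm_eq_abs] at h1
    refine h1.trans (le_of_eq ?_)
    rw [vMax, div_eq_mul_inv, mul_comm]
  exact abs_iSup_le h

/-- The optimal values make the sampling error of a transition centred. -/
theorem integral_tdError_eq_zero [DiscreteMeasurableSpace S] [Nonempty A]
    (hR : m.RewardBounded Rmax) (hγ : 0 ≤ γ) (hγ1 : γ < 1) (x : S × A) : ∫ z, (z.2 + γ * (fun s => ⨆ a', m.optQ γ (s, a')) z.1 - m.optQ γ x)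
      ∂(m.outcome x.1 x.2) = 0 := by
  have := m.isProb x.1 x.2
  have h1 := integrable_reward hR x.1 x.2
  have h2 : Integrable (fun z : S × ℝ => γ * (fun s => ⨆ a', m.optQ γ (s, a')) z.1)
      (m.outcome x.1 x.2) := by
    refine Integrable.const_mul ?_ γ
    refine Integrable.of_bound
      ((measurable_of_finite fun s => ⨆ a', m.optQ γ (s, a')).comp
        measurable_fst).aestronglyMeasurable (vMax Rmax γ) ?_
    exact Filter.Eventually.of_forall fun z => abs_iSup_le fun a' =>
      abs_optQ_le hR hγ hγ1 (z.1, a')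
  have h12 : Integrable (fun z : S × ℝ => z.2 + γ * (fun s => ⨆ a', m.optQ γ (s, a')) z.1)
      (m.outcome x.1 x.2) := h1.add h2
  rw [integral_sub h12 (integrable_const _), integral_add h1 h2, integral_const_mul,
    ← sum_transProb_mul x.1 x.2 (fun s => ⨆ a', m.optQ γ (s, a'))]
  have hb := congrFun (bellman_optQ (m := m) hR hγ hγ1) x
  simp only [bellman, meanReward] at hb
  simp only [integral_const, probReal_univ, one_smul]
  linarith

end MDP

/-! ### A maximal inequality for products of conditionally contracting factors -/

section Ville

variable {Ω : Type*} {m₀ : MeasurableSpace Ω} {μ : Measure Ω}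

theorem lintegral_mul_le_of_setLIntegral_le {m : MeasurableSpace Ω} (hm : m ≤ m₀)
    {g Y : Ω → ℝ≥0∞} (hg : Measurable[m₀] g)
    (h : ∀ A, MeasurableSet[m] A → ∫⁻ ω in A, g ω ∂μ ≤ μ A) (hY : Measurable[m] Y) :
    ∫⁻ ω, Y ω * g ω ∂μ ≤ ∫⁻ ω, Y ω ∂μ := by
  have hle : (μ.withDensity g).trim hm ≤ μ.trim hm := by
    refine Measure.le_iff.2 fun A hA => ?_
    rw [trim_measurableSet_eq hm hA, trim_measurableSet_eq hm hA, withDensity_apply _ (hm A hA)]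
    exact h A hA
  calc ∫⁻ ω, Y ω * g ω ∂μ = ∫⁻ ω, Y ω ∂(μ.withDensity g) := by
        rw [lintegral_withDensity_eq_lintegral_mul μ hg (hY.mono hm le_rfl)]
        simp only [Pi.mul_apply, mul_comm]
    _ = ∫⁻ ω, Y ω ∂((μ.withDensity g).trim hm) := (lintegral_trim hm hY).symm
    _ ≤ ∫⁻ ω, Y ω ∂(μ.trim hm) := lintegral_mono' hle le_rfl
    _ = ∫⁻ ω, Y ω ∂μ := lintegral_trim hm hY

/-- Ville's inequality for the nonnegative supermartingale `∏ i < t, g i`. -/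
theorem mul_measure_exists_le_prod_le [IsProbabilityMeasure μ] (ℱ : Filtration ℕ m₀)
    {g : ℕ → Ω → ℝ≥0∞} (hg : ∀ t, Measurable[ℱ (t + 1)] (g t))
    (h : ∀ t A, MeasurableSet[ℱ t] A → ∫⁻ ω in A, g t ω ∂μ ≤ μ A) (a : ℝ≥0∞) :
    a * μ {ω | ∃ t, a ≤ ∏ i ∈ Finset.range t, g i ω} ≤ 1 := by
  set Y : ℕ → Ω → ℝ≥0∞ := fun t ω => ∏ i ∈ Finset.range t, g i ω with hY
  have hYm : ∀ t, Measurable[ℱ t] (Y t) := by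
    intro t
    refine Finset.measurable_prod _ fun i hi => ?_
    exact (hg i).mono (ℱ.mono (Finset.mem_range.1 hi)) le_rfl
  set B : ℕ → Set Ω := fun t => {ω | ∀ s ≤ t, Y s ω < a} with hB
  have hlt : ∀ t, MeasurableSet[ℱ t] {ω | Y t ω < a} := fun t =>
    (hYm t) (measurableSet_Iio (a := a))
  have hBm : ∀ t, MeasurableSet[ℱ t] (B t) := by
    intro t
    have : B t = ⋂ s : ℕ, ⋂ (_ : s ≤ t), {ω | Y s ω < a} := by ext; simp [hB]
    rw [this]
    exact MeasurableSet.iInter fun s => MeasurableSet.iInter fun hs => ℱ.mono hs _ (hlt s)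
  have hsplit : ∀ t (D : Set Ω), a * μ (D \ {ω | Y t ω < a})
      + ∫⁻ ω in D ∩ {ω | Y t ω < a}, Y t ω ∂μ ≤ ∫⁻ ω in D, Y t ω ∂μ := by
    intro t D
    rw [← lintegral_inter_add_sdiff (Y t) D (ℱ.le t _ (hlt t)), add_comm]
    gcongr
    have hgt : ∀ᵐ ω ∂(μ.restrict {ω | Y t ω < a}ᶜ), a ≤ Y t ω := by
      filter_upwards [ae_restrict_mem (ℱ.le t _ (hlt t)).compl] with ω hω using not_lt.1 hω
    calc a * μ (D \ {ω | Y t ω < a}) = ∫⁻ _ in D \ {ω | Y t ω < a}, a ∂μ := by simp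
      _ ≤ _ := lintegral_mono_ae (ae_restrict_of_ae_restrict_of_subset (fun ω hω => hω.2) hgt)
  have hmain : ∀ t, a * μ (B t)ᶜ + ∫⁻ ω in B t, Y t ω ∂μ ≤ 1 := by
    intro t
    induction t with
    | zero =>
      have h0 := hsplit 0 Set.univ
      have hB0 : B 0 = {ω | Y 0 ω < a} := by ext; simp [hB]
      rw [Set.univ_inter, ← Set.compl_eq_univ_sdiff, ← hB0] at h0
      refine h0.trans ?_
      simp [hY]
    | succ t ih =>
      have hBs : B (t + 1) = B t ∩ {ω | Y (t + 1) ω < a} := by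
        ext ω
        simp only [hB, Set.mem_ofPred_eq, Set.mem_inter_iff, Nat.le_succ_iff]
        constructor
        · intro hω
          exact ⟨fun s hs => hω s (Or.inl hs), hω _ (Or.inr rfl)⟩
        · rintro ⟨h1, h2⟩ s (hs | rfl)
          exacts [h1 s hs, h2]
      have h1 := hsplit (t + 1) (B t)
      have h2 : ∫⁻ ω in B t, Y (t + 1) ω ∂μ ≤ ∫⁻ ω in B t, Y t ω ∂μ := by
        have := lintegral_mul_le_of_setLIntegral_le (ℱ.le t)
          ((hg t).mono (ℱ.le _) le_rfl) (h t) ((hYm t).indicator (hBm t))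
        rw [lintegral_indicator (ℱ.le t _ (hBm t))] at this
        refine le_trans (le_of_eq ?_) this
        rw [← lintegral_indicator (ℱ.le t _ (hBm t))]
        refine lintegral_congr fun ω => ?_
        by_cases hω : ω ∈ B t <;> simp [hω, hY, Finset.prod_range_succ]
      have h3 : μ (B (t + 1))ᶜ ≤ μ (B t)ᶜ + μ (B t \ {ω | Y (t + 1) ω < a}) := by
        refine (measure_mono ?_).trans (measure_union_le _ _)
        rw [hBs]
        intro ω hω
        by_cases hb : ω ∈ B t
        · exact Or.inr ⟨hb, fun hc => hω ⟨hb, hc⟩⟩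
        · exact Or.inl hb
      calc a * μ (B (t + 1))ᶜ + ∫⁻ ω in B (t + 1), Y (t + 1) ω ∂μ
          ≤ a * (μ (B t)ᶜ + μ (B t \ {ω | Y (t + 1) ω < a}))
            + ∫⁻ ω in B t ∩ {ω | Y (t + 1) ω < a}, Y (t + 1) ω ∂μ := by
            rw [← hBs]; gcongr
        _ = a * μ (B t)ᶜ + (a * μ (B t \ {ω | Y (t + 1) ω < a})
            + ∫⁻ ω in B t ∩ {ω | Y (t + 1) ω < a}, Y (t + 1) ω ∂μ) := by ring
        _ ≤ a * μ (B t)ᶜ + ∫⁻ ω in B t, Y t ω ∂μ := by gcongr; exact h1.trans h2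
        _ ≤ 1 := ih
  have hU : {ω | ∃ t, a ≤ ∏ i ∈ Finset.range t, g i ω} = ⋃ t, (B t)ᶜ := by
    ext ω
    simp only [hB, Set.mem_ofPred_eq, Set.mem_iUnion, Set.mem_compl_iff, not_forall, not_lt]
    constructor
    · rintro ⟨t, ht⟩
      exact ⟨t, t, le_rfl, ht⟩
    · rintro ⟨t, s, -, hs⟩
      exact ⟨s, hs⟩
  have hmono : Monotone fun t => (B t)ᶜ := fun s t hst =>
    Set.compl_subset_compl.2 fun ω hω r hr => hω r (hr.trans hst)
  rw [hU, hmono.measure_iUnion, ENNReal.mul_iSup]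
  exact iSup_le fun t => le_self_add.trans (hmain t)

theorem measure_exists_le_sum_le [IsProbabilityMeasure μ] (ℱ : Filtration ℕ m₀)
    {inc : ℕ → Ω → ℝ} (hinc : ∀ t, Measurable[ℱ (t + 1)] (inc t))
    (h : ∀ t A, MeasurableSet[ℱ t] A →
      ∫⁻ ω in A, ENNReal.ofReal (Real.exp (inc t ω)) ∂μ ≤ μ A) (p : ℝ) :
    μ {ω | ∃ t, p ≤ ∑ i ∈ Finset.range t, inc i ω} ≤ ENNReal.ofReal (Real.exp (-p)) := by
  have hv := mul_measure_exists_le_prod_le ℱ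
    (g := fun t ω => ENNReal.ofReal (Real.exp (inc t ω)))
    (fun t => (Real.measurable_exp.comp (hinc t)).ennreal_ofReal) h
    (ENNReal.ofReal (Real.exp p))
  have hset : {ω | ∃ t, ENNReal.ofReal (Real.exp p)
      ≤ ∏ i ∈ Finset.range t, ENNReal.ofReal (Real.exp (inc i ω))}
      = {ω | ∃ t, p ≤ ∑ i ∈ Finset.range t, inc i ω} := by
    ext ω
    simp only [Set.mem_ofPred_eq]
    refine exists_congr fun t => ?_
    rw [← ENNReal.ofReal_prod_of_nonneg fun i _ => (Real.exp_pos _).le, ← Real.exp_sum,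
      ENNReal.ofReal_le_ofReal_iff (Real.exp_pos _).le, Real.exp_le_exp]
  rw [hset] at hv
  rw [Real.exp_neg, ENNReal.ofReal_inv_of_pos (Real.exp_pos p), ← one_div]
  rw [ENNReal.le_div_iff_mul_le (Or.inl (by simpa using Real.exp_pos p)) (Or.inl (by simp)),
    mul_comm]
  exact hv

end Ville

/-! ### Exponential moments of bounded centred variables -/

theorem exp_le_one_add_add_sq {y b : ℝ} (hb : b ≤ 1) (hy : |y| ≤ b) :
    Real.exp y ≤ 1 + y + b ^ 2 := by
  have h := (abs_le.1 (Real.abs_exp_sub_one_sub_id_le (hy.trans hb))).2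
  have h2 : y ^ 2 ≤ b ^ 2 := sq_le_sq' (by linarith [(abs_le.1 hy).1]) (abs_le.1 hy).2
  linarith

theorem lintegral_exp_sub_sq_le_one {Ω : Type*} [MeasurableSpace Ω] {ν : Measure Ω}
    [IsProbabilityMeasure ν] {y : Ω → ℝ} {b : ℝ} (hb : b ≤ 1) (hym : Measurable y)
    (hy : ∀ᵐ z ∂ν, |y z| ≤ b) (hmean : ∫ z, y z ∂ν = 0) :
    ∫⁻ z, ENNReal.ofReal (Real.exp (y z - b ^ 2)) ∂ν ≤ 1 := by
  have hint : Integrable y ν := Integrable.of_bound hym.aestronglyMeasurable b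
    (by simpa [Real.norm_eq_abs] using hy)
  have hle : ∀ᵐ z ∂ν, Real.exp (y z - b ^ 2) ≤ (1 + y z + b ^ 2) * Real.exp (-b ^ 2) := by
    filter_upwards [hy] with z hz
    rw [sub_eq_add_neg, Real.exp_add]
    exact mul_le_mul_of_nonneg_right (exp_le_one_add_add_sq hb hz) (Real.exp_pos _).le
  have hint2 : Integrable (fun z => (1 + y z + b ^ 2) * Real.exp (-b ^ 2)) ν :=
    (((integrable_const 1).add hint).add (integrable_const _)).mul_const _
  calc ∫⁻ z, ENNReal.ofReal (Real.exp (y z - b ^ 2)) ∂ν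
      ≤ ∫⁻ z, ENNReal.ofReal ((1 + y z + b ^ 2) * Real.exp (-b ^ 2)) ∂ν :=
        lintegral_mono_ae (by filter_upwards [hle] with z hz using ENNReal.ofReal_le_ofReal hz)
    _ = ENNReal.ofReal (∫ z, (1 + y z + b ^ 2) * Real.exp (-b ^ 2) ∂ν) := by
        refine (ofReal_integral_eq_lintegral_ofReal hint2 ?_).symm
        filter_upwards [hle] with z hz
        exact (Real.exp_pos _).le.trans hz
    _ = ENNReal.ofReal ((1 + b ^ 2) * Real.exp (-b ^ 2)) := by
        have h1 : Integrable (fun z => 1 + y z) ν := (integrable_const 1).add hint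
        rw [integral_mul_const, integral_add h1 (integrable_const _),
          integral_add (integrable_const 1) hint, hmean]
        simp
    _ ≤ 1 := by
        rw [← ENNReal.ofReal_one]
        refine ENNReal.ofReal_le_ofReal ?_
        rw [Real.exp_neg, ← div_eq_mul_inv, div_le_one (Real.exp_pos _), add_comm]
        exact Real.add_one_le_exp _

theorem sum_exp_sub_sq_le_card {ι : Type*} {s : Finset ι} {y : ι → ℝ} {b : ℝ} (hb : b ≤ 1)
    (hy : ∀ i ∈ s, |y i| ≤ b) (hmean : ∑ i ∈ s, y i = 0) :
    ∑ i ∈ s, Real.exp (y i - b ^ 2) ≤ s.card := by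
  calc ∑ i ∈ s, Real.exp (y i - b ^ 2)
      ≤ ∑ i ∈ s, (1 + y i + b ^ 2) * Real.exp (-b ^ 2) := by
        refine Finset.sum_le_sum fun i hi => ?_
        rw [sub_eq_add_neg, Real.exp_add]
        exact mul_le_mul_of_nonneg_right (exp_le_one_add_add_sq hb (hy i hi)) (Real.exp_pos _).le
    _ = s.card * ((1 + b ^ 2) * Real.exp (-b ^ 2)) := by
        rw [← Finset.sum_mul, Finset.sum_add_distrib, Finset.sum_add_distrib, hmean]
        simp
        ring
    _ ≤ s.card * 1 := by
        refine mul_le_mul_of_nonneg_left ?_ (Nat.cast_nonneg _)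
        rw [Real.exp_neg, ← div_eq_mul_inv, div_le_one (Real.exp_pos _), add_comm]
        exact Real.add_one_le_exp _
    _ = s.card := mul_one _

namespace Run

/-! ### Conditional laws of the samples -/

section Defs

variable {S A Ω : Type*} (run : Run S A Ω) (K M : ℕ)

/-- The state-action pair of iteration `t`, meaningful if that is an online iteration. -/
def pair (t : ℕ) (ω : Ω) : S × A := (run.state t ω, run.action t ω)

/-- The sampling error of the transition stored at iteration `j`, for a state-value function `V` and
a state-action-value function `q`. With the optimal values of the decision process for `V` and `q`
it has conditional mean `0`, whatever the current estimates of the learner are. -/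
def tdNoise (γ : ℝ) (V : S → ℝ) (q : S × A → ℝ) (j : ℕ) (ω : Ω) : ℝ :=
  run.reward j ω + γ * V (run.state (j + 1) ω) - q (run.pair j ω)

open Classical in
/-- The stored transitions at the pair `x` at the beginning of iteration `t`. -/
noncomputable def visits (t : ℕ) (ω : Ω) (x : S × A) : Finset ℕ :=
  (memory K M t).filter fun j => run.pair j ω = x

/-- The mean sampling error over the stored transitions at `x`. -/
noncomputable def empMean (γ : ℝ) (V : S → ℝ) (q : S × A → ℝ) (t : ℕ) (ω : Ω) (x : S × A) : ℝ :=
  (∑ j ∈ run.visits K M t ω x, run.tdNoise γ V q j ω) / (run.visits K M t ω x).card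

open Classical in
/-- The exponent of the factor that iteration `t` contributes to the exponential supermartingale of
the online sampling errors at `x`. -/
noncomputable def onlineExponent (γ : ℝ) (V : S → ℝ) (q : S × A → ℝ) (lam b : ℝ) (x : S × A)
    (t : ℕ) (ω : Ω) : ℝ :=
  if IsOnline K M t ∧ run.pair t ω = x then lam * run.tdNoise γ V q t ω - b ^ 2 else 0

open Classical in
/-- The exponent of the factor that iteration `t` contributes to the exponential supermartingale of
the sampling errors of all updates at `x`, where the error of a replayed transition is centred at
the mean over the memory. The sum over the memory, instead of the transition `replayed t` itself,
keeps the exponent measurable at time `t + 1` on the null set where `replayed t` lies outside the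
memory. -/
noncomputable def updateExponent (γ : ℝ) (V : S → ℝ) (q : S × A → ℝ) (lam b : ℝ) (x : S × A)
    (t : ℕ) (ω : Ω) : ℝ :=
  if IsOnline K M t then run.onlineExponent K M γ V q lam b x t ω
  else ∑ j ∈ memory K M t, if run.replayed t ω = j ∧ run.pair j ω = x then
    lam * (run.tdNoise γ V q j ω - run.empMean K M γ V q t ω x) - b ^ 2 else 0

end Defs

section Laws

variable {S A Ω : Type*} [MeasurableSpace S] [MeasurableSpace A] {mΩ : MeasurableSpace Ω}
  {m : MDP S A} {K M : ℕ} {μ : Measure Ω} {ℱ : Filtration ℕ mΩ} {run : Run S A Ω}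

theorem mem_memory {t j : ℕ} : j ∈ memory K M t ↔ j < t ∧ IsOnline K M j := by
  simp [memory]

namespace IsReplayQLearning

theorem pair_measurable (h : run.IsReplayQLearning m K M μ ℱ) {s t : ℕ} (hst : s ≤ t) :
    Measurable[ℱ t] (run.pair s) :=
  ((h.state_measurable s).mono (ℱ.mono hst) le_rfl).prodMk
    ((h.action_measurable s).mono (ℱ.mono hst) le_rfl)

section Measurability

variable [Finite S] [Finite A] [DiscreteMeasurableSpace S] [DiscreteMeasurableSpace A]
  {γ : ℝ} {V : S → ℝ} {q : S × A → ℝ}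

theorem tdNoise_measurable (h : run.IsReplayQLearning m K M μ ℱ) {s t : ℕ} (hst : s + 1 ≤ t) :
    Measurable[ℱ t] (run.tdNoise γ V q s) := by
  have h1 : Measurable[ℱ t] (run.reward s) := (h.reward_measurable s).mono (ℱ.mono hst) le_rfl
  have h2 : Measurable[ℱ t] fun ω => V (run.state (s + 1) ω) :=
    (measurable_of_finite V).comp ((h.state_measurable (s + 1)).mono (ℱ.mono hst) le_rfl)
  have h3 : Measurable[ℱ t] fun ω => q (run.pair s ω) :=
    (measurable_of_finite q).comp (h.pair_measurable (by omega))
  exact (h1.add (h2.const_mul γ)).sub h3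

theorem measurableSet_pair_eq (h : run.IsReplayQLearning m K M μ ℱ) {s t : ℕ} (hst : s ≤ t)
    (x : S × A) : MeasurableSet[ℱ t] {ω | run.pair s ω = x} :=
  h.pair_measurable hst (measurableSet_singleton x)

theorem empMean_measurable (h : run.IsReplayQLearning m K M μ ℱ) (t : ℕ) (x : S × A) :
    Measurable[ℱ t] fun ω => run.empMean K M γ V q t ω x := by
  classical
  have h1 : Measurable[ℱ t] fun ω => ∑ j ∈ memory K M t,
      if run.pair j ω = x then run.tdNoise γ V q j ω else 0 := by
    refine Finset.measurable_sum _ fun j hj => ?_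
    have hjt := (mem_memory.1 hj).1
    exact Measurable.ite (h.measurableSet_pair_eq hjt.le x) (h.tdNoise_measurable hjt)
      measurable_const
  have h2 : Measurable[ℱ t] fun ω => ∑ j ∈ memory K M t,
      if run.pair j ω = x then (1 : ℝ) else 0 := by
    refine Finset.measurable_sum _ fun j hj => ?_
    exact Measurable.ite (h.measurableSet_pair_eq (mem_memory.1 hj).1.le x) measurable_const
      measurable_const
  convert h1.div h2 using 2 with ω
  simp only [empMean, visits, Finset.sum_filter, Finset.card_filter, Pi.div_apply]
  push_cast
  congr!

theorem onlineExponent_measurable (h : run.IsReplayQLearning m K M μ ℱ) (lam b : ℝ) (x : S × A)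
    (t : ℕ) : Measurable[ℱ (t + 1)] (run.onlineExponent K M γ V q lam b x t) := by
  classical
  have hs : MeasurableSet[ℱ (t + 1)] {ω | IsOnline K M t ∧ run.pair t ω = x} := by
    by_cases ht : IsOnline K M t
    · simpa [ht] using h.measurableSet_pair_eq (Nat.le_succ t) x
    · simp [ht]
  exact Measurable.ite hs (((h.tdNoise_measurable le_rfl).const_mul lam).sub_const _)
    measurable_const

theorem updateExponent_measurable (h : run.IsReplayQLearning m K M μ ℱ) (lam b : ℝ) (x : S × A)
    (t : ℕ) : Measurable[ℱ (t + 1)] (run.updateExponent K M γ V q lam b x t) := by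
  classical
  by_cases ht : IsOnline K M t
  · convert h.onlineExponent_measurable (γ := γ) (V := V) (q := q) lam b x t using 1
    funext ω
    simp [updateExponent, ht]
  · have : Measurable[ℱ (t + 1)] fun ω => ∑ j ∈ memory K M t,
        if run.replayed t ω = j ∧ run.pair j ω = x then
          lam * (run.tdNoise γ V q j ω - run.empMean K M γ V q t ω x) - b ^ 2 else 0 := by
      refine Finset.measurable_sum _ fun j hj => ?_
      have hjt := (mem_memory.1 hj).1
      refine Measurable.ite ?_ ((((h.tdNoise_measurable (by omega)).sub
        ((h.empMean_measurable t x).mono (ℱ.mono (Nat.le_succ t)) le_rfl)).const_mul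
          lam).sub_const _) measurable_const
      exact (h.replayed_measurable t (measurableSet_singleton j)).inter
        (h.measurableSet_pair_eq (by omega) x)
    convert this using 1
    funext ω
    simp only [updateExponent, ht, if_false]

end Measurability

variable [IsProbabilityMeasure μ]

theorem measure_inter_online (h : run.IsReplayQLearning m K M μ ℱ) {t : ℕ}
    (ht : IsOnline K M t) {x : S × A} {E : Set Ω} (hE : MeasurableSet[ℱ t] E)
    (hx : ∀ ω ∈ E, run.pair t ω = x) {B : Set (S × ℝ)} (hB : MeasurableSet B) :
    μ ((fun ω => (run.state (t + 1) ω, run.reward t ω)) ⁻¹' B ∩ E)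
      = μ E * m.outcome x.1 x.2 B := by
  have hprob := m.isProb x.1 x.2
  have hf : Measurable fun ω => (run.state (t + 1) ω, run.reward t ω) :=
    ((h.state_measurable (t + 1)).mono (ℱ.le _) le_rfl).prodMk
      ((h.reward_measurable t).mono (ℱ.le _) le_rfl)
  have hpre := hf hB
  have h1 := setIntegral_condExp (ℱ.le t)
    ((integrable_const (1 : ℝ)).indicator hpre : Integrable _ μ) hE
  have h2 : ∫ ω in E, (μ⟦(fun ω => (run.state (t + 1) ω, run.reward t ω)) ⁻¹' B | ℱ t⟧) ω ∂μ
      = ∫ _ in E, (m.outcome x.1 x.2).real B ∂μ := by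
    refine setIntegral_congr_ae (ℱ.le t _ hE) ?_
    filter_upwards [h.online_law t ht B hB] with ω hω hωE
    have := hx ω hωE
    rw [hω, ← this]
    rfl
  rw [h2, integral_indicator_const _ hpre] at h1
  simp only [setIntegral_const, smul_eq_mul, mul_one] at h1
  rw [measureReal_restrict_apply hpre] at h1
  rw [← ofReal_measureReal (measure_ne_top μ _), ← h1, ENNReal.ofReal_mul measureReal_nonneg,
    ofReal_measureReal (measure_ne_top μ _), ofReal_measureReal (measure_ne_top _ _)]

theorem setLIntegral_online (h : run.IsReplayQLearning m K M μ ℱ) {t : ℕ}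
    (ht : IsOnline K M t) {x : S × A} {E : Set Ω} (hE : MeasurableSet[ℱ t] E)
    (hx : ∀ ω ∈ E, run.pair t ω = x) {f : S × ℝ → ℝ≥0∞} (hf : Measurable f) :
    ∫⁻ ω in E, f (run.state (t + 1) ω, run.reward t ω) ∂μ
      = μ E * ∫⁻ z, f z ∂(m.outcome x.1 x.2) := by
  have hg : Measurable fun ω => (run.state (t + 1) ω, run.reward t ω) :=
    ((h.state_measurable (t + 1)).mono (ℱ.le _) le_rfl).prodMk
      ((h.reward_measurable t).mono (ℱ.le _) le_rfl)
  have hmap : (μ.restrict E).map (fun ω => (run.state (t + 1) ω, run.reward t ω))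
      = μ E • m.outcome x.1 x.2 := by
    refine Measure.ext fun B hB => ?_
    rw [Measure.map_apply hg hB, Measure.restrict_apply (hg hB), h.measure_inter_online ht hE hx hB,
      Measure.smul_apply, smul_eq_mul]
  rw [← lintegral_map hf hg, hmap, lintegral_smul_measure, smul_eq_mul]

theorem ae_abs_reward_le (h : run.IsReplayQLearning m K M μ ℱ) [Finite S] [Finite A]
    [DiscreteMeasurableSpace S] [DiscreteMeasurableSpace A] {Rmax : ℝ}
    (hR : m.RewardBounded Rmax) : ∀ᵐ ω ∂μ, ∀ t, IsOnline K M t → |run.reward t ω| ≤ Rmax := by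
  rw [ae_all_iff]
  intro t
  by_cases ht : IsOnline K M t
  swap
  · simp [ht]
  have hx : ∀ x : S × A, ∀ᵐ ω ∂μ, run.pair t ω = x → |run.reward t ω| ≤ Rmax := by
    intro x
    have hE : MeasurableSet[ℱ t] (run.pair t ⁻¹' {x}) :=
      h.pair_measurable le_rfl (measurableSet_singleton x)
    have hB : MeasurableSet {z : S × ℝ | ¬ |z.2| ≤ Rmax} :=
      (measurableSet_le (measurable_snd.norm) measurable_const).compl
    have h1 := h.measure_inter_online ht hE (fun ω hω => hω) hB
    have h2 : m.outcome x.1 x.2 {z : S × ℝ | ¬ |z.2| ≤ Rmax} = 0 := hR x.1 x.2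
    rw [h2, mul_zero] at h1
    refine measure_mono_null ?_ h1
    intro ω hω
    have hω' : ¬ (run.pair t ω = x → |run.reward t ω| ≤ Rmax) := hω
    rw [Classical.not_imp] at hω'
    exact ⟨hω'.2, hω'.1⟩
  filter_upwards [ae_all_iff.2 hx] with ω hω _ using hω _ rfl

theorem measure_inter_replayed (h : run.IsReplayQLearning m K M μ ℱ) {t j : ℕ}
    (ht : ¬ IsOnline K M t) (hj : j ∈ memory K M t) {E : Set Ω} (hE : MeasurableSet[ℱ t] E) :
    μ (run.replayed t ⁻¹' {j} ∩ E) = ((memory K M t).card : ℝ≥0∞)⁻¹ * μ E := by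
  have hpos : (0 : ℝ) < (memory K M t).card := by exact_mod_cast Finset.card_pos.2 ⟨j, hj⟩
  have hpre : MeasurableSet (run.replayed t ⁻¹' {j}) :=
    ℱ.le _ _ (h.replayed_measurable t (measurableSet_singleton j))
  have h1 := setIntegral_condExp (ℱ.le t)
    ((integrable_const (1 : ℝ)).indicator hpre : Integrable _ μ) hE
  have h2 : ∫ ω in E, (μ⟦run.replayed t ⁻¹' {j} | ℱ t⟧) ω ∂μ
      = ∫ _ in E, 1 / ((memory K M t).card : ℝ) ∂μ := by
    refine setIntegral_congr_ae (ℱ.le t _ hE) ?_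
    filter_upwards [h.replay_law t ht j hj] with ω hω _ using hω
  rw [h2, integral_indicator_const _ hpre] at h1
  simp only [setIntegral_const, smul_eq_mul, mul_one] at h1
  rw [measureReal_restrict_apply hpre] at h1
  rw [← ofReal_measureReal (measure_ne_top μ _), ← h1, ENNReal.ofReal_mul measureReal_nonneg,
    ofReal_measureReal (measure_ne_top μ _), one_div, ENNReal.ofReal_inv_of_pos hpos,
    ENNReal.ofReal_natCast, mul_comm]

theorem setLIntegral_replayed (h : run.IsReplayQLearning m K M μ ℱ) {t j : ℕ}
    (ht : ¬ IsOnline K M t) (hj : j ∈ memory K M t) {E : Set Ω} (hE : MeasurableSet[ℱ t] E)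
    {F : Ω → ℝ≥0∞} (hF : Measurable[ℱ t] F) :
    ∫⁻ ω in E, (run.replayed t ⁻¹' {j}).indicator F ω ∂μ
      = ((memory K M t).card : ℝ≥0∞)⁻¹ * ∫⁻ ω in E, F ω ∂μ := by
  have hpre : MeasurableSet (run.replayed t ⁻¹' {j}) :=
    ℱ.le _ _ (h.replayed_measurable t (measurableSet_singleton j))
  have htrim : ((μ.restrict E).restrict (run.replayed t ⁻¹' {j})).trim (ℱ.le t)
      = (((memory K M t).card : ℝ≥0∞)⁻¹ • μ.restrict E).trim (ℱ.le t) := by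
    refine @Measure.ext _ (ℱ t) _ _ fun D hD => ?_
    rw [trim_measurableSet_eq _ hD, trim_measurableSet_eq _ hD, Measure.smul_apply, smul_eq_mul,
      Measure.restrict_apply (ℱ.le t _ hD), Measure.restrict_apply ((ℱ.le t _ hD).inter hpre),
      Measure.restrict_apply (ℱ.le t _ hD), ← h.measure_inter_replayed ht hj (hD.inter hE)]
    congr 1
    ext ω
    simp only [Set.mem_inter_iff]
    tauto
  rw [lintegral_indicator hpre, ← lintegral_trim (ℱ.le t) hF, htrim, lintegral_trim (ℱ.le t) hF,
    lintegral_smul_measure, smul_eq_mul]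

theorem ae_replayed_mem (h : run.IsReplayQLearning m K M μ ℱ) (hK : 1 ≤ K) :
    ∀ᵐ ω ∂μ, ∀ t, ¬ IsOnline K M t → run.replayed t ω ∈ memory K M t := by
  rw [ae_all_iff]
  intro t
  by_cases ht : IsOnline K M t
  · simp [ht]
  have h0 : 0 ∈ memory K M t := by
    refine mem_memory.2 ⟨Nat.pos_of_ne_zero ?_, ?_⟩
    · rintro rfl
      exact ht (by simp only [IsOnline, Nat.zero_mod]; omega)
    · simp only [IsOnline, Nat.zero_mod]; omega
  have hcard : (memory K M t).card ≠ 0 := (Finset.card_pos.2 ⟨0, h0⟩).ne'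
  have hmeas : ∀ j, MeasurableSet (run.replayed t ⁻¹' {j}) := fun j =>
    ℱ.le _ _ (h.replayed_measurable t (measurableSet_singleton j))
  have h1 : μ (run.replayed t ⁻¹' (memory K M t : Set ℕ)) = 1 := by
    rw [← sum_measure_preimage_singleton _ fun j _ => hmeas j]
    have : ∀ j ∈ memory K M t, μ (run.replayed t ⁻¹' {j}) = ((memory K M t).card : ℝ≥0∞)⁻¹ := by
      intro j hj
      simpa using h.measure_inter_replayed ht hj (E := Set.univ) MeasurableSet.univ
    rw [Finset.sum_congr rfl this, Finset.sum_const, nsmul_eq_mul]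
    exact ENNReal.mul_inv_cancel (by exact_mod_cast hcard) (by simp)
  have hms : MeasurableSet (run.replayed t ⁻¹' (memory K M t : Set ℕ)) :=
    ℱ.le _ _ (h.replayed_measurable t (Finset.measurableSet _))
  have h2 : ∀ᵐ ω ∂μ, ω ∈ run.replayed t ⁻¹' (memory K M t : Set ℕ) := by
    rw [← prob_compl_eq_zero_iff hms] at h1
    exact h1
  filter_upwards [h2] with ω hω _ using hω

/-! ### The exponential supermartingales of the sampling errors -/

variable [Finite S] [Finite A] [DiscreteMeasurableSpace S] [DiscreteMeasurableSpace A]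
  {γ : ℝ} {V : S → ℝ} {q : S × A → ℝ}

theorem setLIntegral_exp_onlineExponent_le (h : run.IsReplayQLearning m K M μ ℱ) {Rmax σ : ℝ}
    (hR : m.RewardBounded Rmax) {x : S × A}
    (hσ : ∀ z : S × ℝ, |z.2| ≤ Rmax → |z.2 + γ * V z.1 - q x| ≤ σ)
    (hmean : ∫ z, (z.2 + γ * V z.1 - q x) ∂(m.outcome x.1 x.2) = 0)
    {lam b : ℝ} (hb : |lam| * σ ≤ b) (hb1 : b ≤ 1) (t : ℕ) {E : Set Ω}
    (hE : MeasurableSet[ℱ t] E) :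
    ∫⁻ ω in E, ENNReal.ofReal (Real.exp (run.onlineExponent K M γ V q lam b x t ω)) ∂μ ≤ μ E := by
  by_cases ht : IsOnline K M t
  swap
  · simp [onlineExponent, ht]
  have := m.isProb x.1 x.2
  have hP := h.measurableSet_pair_eq le_rfl x (t := t)
  have hy : Measurable fun z : S × ℝ => lam * (z.2 + γ * V z.1 - q x) :=
    ((measurable_snd.add (((measurable_of_finite V).comp measurable_fst).const_mul γ)).sub_const
      _).const_mul lam
  have hmgf : ∫⁻ z, ENNReal.ofReal (Real.exp (lam * (z.2 + γ * V z.1 - q x) - b ^ 2))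
      ∂(m.outcome x.1 x.2) ≤ 1 := by
    refine lintegral_exp_sub_sq_le_one hb1 hy ?_ ?_
    · filter_upwards [hR x.1 x.2] with z hz
      rw [abs_mul]
      exact (mul_le_mul_of_nonneg_left (hσ z hz) (abs_nonneg _)).trans hb
    · rw [integral_const_mul, hmean, mul_zero]
  have hin := h.setLIntegral_online ht (hE.inter hP) (fun ω hω => hω.2)
    (f := fun z => ENNReal.ofReal (Real.exp (lam * (z.2 + γ * V z.1 - q x) - b ^ 2)))
    (hy.sub_const _).exp.ennreal_ofReal
  rw [← lintegral_inter_add_sdiff _ E (ℱ.le t _ hP), ← measure_inter_add_sdiff E (ℱ.le t _ hP)]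
  refine add_le_add ?_ ?_
  · calc ∫⁻ ω in E ∩ {ω | run.pair t ω = x},
          ENNReal.ofReal (Real.exp (run.onlineExponent K M γ V q lam b x t ω)) ∂μ
        = μ (E ∩ {ω | run.pair t ω = x}) * ∫⁻ z, ENNReal.ofReal
            (Real.exp (lam * (z.2 + γ * V z.1 - q x) - b ^ 2)) ∂(m.outcome x.1 x.2) := by
          rw [← hin]
          refine setLIntegral_congr_fun (ℱ.le t _ (hE.inter hP)) fun ω hω => ?_
          have hω2 : run.pair t ω = x := hω.2
          simp only [onlineExponent, ht, hω2, and_self, if_true, tdNoise]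
      _ ≤ μ (E ∩ {ω | run.pair t ω = x}) * 1 := by gcongr
      _ = _ := mul_one _
  · refine le_of_eq ?_
    rw [setLIntegral_congr_fun (g := fun _ => 1) ((ℱ.le t _ hE).diff (ℱ.le t _ hP))]
    · simp
    · intro ω hω
      have hω2 : ¬ run.pair t ω = x := hω.2
      simp [onlineExponent, hω2]

theorem setLIntegral_exp_updateExponent_le (h : run.IsReplayQLearning m K M μ ℱ) (hK : 1 ≤ K)
    {Rmax σ : ℝ} (hR : m.RewardBounded Rmax) {x : S × A}
    (hσ : ∀ z : S × ℝ, |z.2| ≤ Rmax → |z.2 + γ * V z.1 - q x| ≤ σ)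
    (hmean : ∫ z, (z.2 + γ * V z.1 - q x) ∂(m.outcome x.1 x.2) = 0)
    {lam b : ℝ} (hb : |lam| * (2 * σ) ≤ b) (hb1 : b ≤ 1) (hσ0 : 0 ≤ σ) (t : ℕ) {E : Set Ω}
    (hE : MeasurableSet[ℱ t] E) :
    ∫⁻ ω in E, ENNReal.ofReal (Real.exp (run.updateExponent K M γ V q lam b x t ω)) ∂μ ≤ μ E := by
  classical
  by_cases ht : IsOnline K M t
  · simp only [updateExponent, ht, if_true]
    refine h.setLIntegral_exp_onlineExponent_le hR hσ hmean (le_trans ?_ hb) hb1 t hE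
    have := abs_nonneg lam
    nlinarith
  set φ : ℕ → Ω → ℝ := fun j ω => if run.pair j ω = x then
    lam * (run.tdNoise γ V q j ω - run.empMean K M γ V q t ω x) - b ^ 2 else 0 with hφ
  have hφm : ∀ j ∈ memory K M t, Measurable[ℱ t] fun ω => ENNReal.ofReal (Real.exp (φ j ω)) := by
    intro j hj
    have hjt := (mem_memory.1 hj).1
    refine (Real.measurable_exp.comp ?_).ennreal_ofReal
    exact Measurable.ite (h.measurableSet_pair_eq hjt.le x)
      ((((h.tdNoise_measurable hjt).sub (h.empMean_measurable t x)).const_mul lam).sub_const _)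
      measurable_const
  -- The mean over the memory of the exponentials is at most one, since the errors are centred.
  have hpoint : ∀ᵐ ω ∂μ, ((memory K M t).card : ℝ≥0∞)⁻¹ *
      ∑ j ∈ memory K M t, ENNReal.ofReal (Real.exp (φ j ω)) ≤ 1 := by
    filter_upwards [h.ae_abs_reward_le hR] with ω hω
    rw [← ENNReal.ofReal_sum_of_nonneg fun j _ => (Real.exp_pos _).le]
    have hξ : ∀ j ∈ run.visits K M t ω x, |run.tdNoise γ V q j ω| ≤ σ := by
      intro j hj
      have hj' := Finset.mem_filter.1 hj
      have := hσ (run.state (j + 1) ω, run.reward j ω) (hω j (mem_memory.1 hj'.1).2)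
      simpa [tdNoise, hj'.2] using this
    have hsum : ∑ j ∈ memory K M t, Real.exp (φ j ω) ≤ (memory K M t).card := by
      rw [← Finset.sum_filter_add_sum_filter_not (memory K M t) (fun j => run.pair j ω = x)]
      have hvis : (memory K M t).filter (fun j => run.pair j ω = x) = run.visits K M t ω x := by
        simp only [visits]
      have h2 : ∑ j ∈ (memory K M t).filter (fun j => ¬ run.pair j ω = x), Real.exp (φ j ω)
          = ((memory K M t).filter (fun j => ¬ run.pair j ω = x)).card := by
        rw [Finset.sum_congr rfl (g := fun _ => (1 : ℝ))]
        · simp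
        · intro j hj
          simp [hφ, (Finset.mem_filter.1 hj).2]
      have h1 : ∑ j ∈ (memory K M t).filter (fun j => run.pair j ω = x), Real.exp (φ j ω)
          ≤ ((memory K M t).filter (fun j => run.pair j ω = x)).card := by
        rw [hvis]
        refine le_trans (le_of_eq ?_) (sum_exp_sub_sq_le_card hb1
          (y := fun j => lam * (run.tdNoise γ V q j ω - run.empMean K M γ V q t ω x)) ?_ ?_)
        · refine Finset.sum_congr rfl fun j hj => ?_
          simp [hφ, (Finset.mem_filter.1 hj).2]
        · intro j hj
          have hpos : (0 : ℝ) < (run.visits K M t ω x).card := by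
            exact_mod_cast Finset.card_pos.2 ⟨j, hj⟩
          have hmeanle : |run.empMean K M γ V q t ω x| ≤ σ := by
            rw [empMean, abs_div, abs_of_pos hpos, div_le_iff₀ hpos]
            calc _ ≤ ∑ j ∈ run.visits K M t ω x, |run.tdNoise γ V q j ω| :=
                  Finset.abs_sum_le_sum_abs _ _
              _ ≤ _ := by
                  have := Finset.sum_le_card_nsmul _ _ _ hξ
                  rw [nsmul_eq_mul] at this
                  linarith
          rw [abs_mul]
          refine (mul_le_mul_of_nonneg_left ?_ (abs_nonneg _)).trans hb
          calc _ ≤ |run.tdNoise γ V q j ω| + |run.empMean K M γ V q t ω x| := abs_sub _ _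
            _ ≤ 2 * σ := by linarith [hξ j hj]
        · rw [← Finset.mul_sum, Finset.sum_sub_distrib, Finset.sum_const, nsmul_eq_mul, empMean]
          rcases Finset.eq_empty_or_nonempty (run.visits K M t ω x) with he | hne
          · simp [he]
          · have hpos : ((run.visits K M t ω x).card : ℝ) ≠ 0 := by
              exact_mod_cast (Finset.card_pos.2 hne).ne'
            rw [mul_div_cancel₀ _ hpos]
            ring
      rw [h2]
      have h3 := Finset.card_filter_add_card_filter_not (s := memory K M t)
        (fun j => run.pair j ω = x)
      have h4 : (((memory K M t).filter (fun j => run.pair j ω = x)).card : ℝ)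
          + ((memory K M t).filter (fun j => ¬ run.pair j ω = x)).card = (memory K M t).card := by
        exact_mod_cast h3
      linarith
    calc ((memory K M t).card : ℝ≥0∞)⁻¹ * ENNReal.ofReal (∑ j ∈ memory K M t, Real.exp (φ j ω))
        ≤ ((memory K M t).card : ℝ≥0∞)⁻¹ * ((memory K M t).card : ℝ≥0∞) := by
          gcongr
          rw [← ENNReal.ofReal_natCast]
          exact ENNReal.ofReal_le_ofReal hsum
      _ ≤ 1 := ENNReal.inv_mul_le_one _
  have hexp : ∀ᵐ ω ∂μ, ENNReal.ofReal (Real.exp (run.updateExponent K M γ V q lam b x t ω))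
      = ∑ j ∈ memory K M t, (run.replayed t ⁻¹' {j}).indicator
          (fun ω => ENNReal.ofReal (Real.exp (φ j ω))) ω := by
    filter_upwards [h.ae_replayed_mem hK] with ω hω
    have hmem := hω t ht
    rw [Finset.sum_eq_single_of_mem _ hmem]
    · simp only [updateExponent, ht, if_false, hφ]
      rw [Finset.sum_eq_single_of_mem _ hmem]
      · simp
      · intro j _ hj
        simp [hj.symm]
    · intro j _ hj
      simp [hj.symm]
  calc ∫⁻ ω in E, ENNReal.ofReal (Real.exp (run.updateExponent K M γ V q lam b x t ω)) ∂μ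
      = ∫⁻ ω in E, ∑ j ∈ memory K M t, (run.replayed t ⁻¹' {j}).indicator
          (fun ω => ENNReal.ofReal (Real.exp (φ j ω))) ω ∂μ :=
        lintegral_congr_ae (ae_restrict_of_ae hexp)
    _ = ∑ j ∈ memory K M t, ∫⁻ ω in E, (run.replayed t ⁻¹' {j}).indicator
          (fun ω => ENNReal.ofReal (Real.exp (φ j ω))) ω ∂μ := by
        refine lintegral_finsetSum _ fun j hj => ?_
        exact ((hφm j hj).mono (ℱ.le t) le_rfl).indicator
          (ℱ.le _ _ (h.replayed_measurable t (measurableSet_singleton j)))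
    _ = ∑ j ∈ memory K M t, ((memory K M t).card : ℝ≥0∞)⁻¹ *
          ∫⁻ ω in E, ENNReal.ofReal (Real.exp (φ j ω)) ∂μ :=
        Finset.sum_congr rfl fun j hj => h.setLIntegral_replayed ht hj hE (hφm j hj)
    _ = ∫⁻ ω in E, ((memory K M t).card : ℝ≥0∞)⁻¹ *
          ∑ j ∈ memory K M t, ENNReal.ofReal (Real.exp (φ j ω)) ∂μ := by
        rw [lintegral_const_mul, lintegral_finsetSum, Finset.mul_sum]
        · exact fun j hj => (hφm j hj).mono (ℱ.le t) le_rfl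
        · exact Finset.measurable_sum _ fun j hj => (hφm j hj).mono (ℱ.le t) le_rfl
    _ ≤ ∫⁻ _ in E, 1 ∂μ := lintegral_mono_ae (ae_restrict_of_ae hpoint)
    _ = μ E := by simp

end IsReplayQLearning

end Laws

/-! ### The error of the estimates along a sample path -/

section Path

variable {S A Ω : Type*} {run : Run S A Ω} {K M : ℕ} {γ : ℝ} {ω : Ω}

open Classical in
/-- The iterations before `t` that update the value at `x`. -/
noncomputable def updates (run : Run S A Ω) (K M t : ℕ) (ω : Ω) (x : S × A) : Finset ℕ :=
  (Finset.range t).filter fun i => run.updatedPair K M i ω = x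

theorem updatedPair_eq (i : ℕ) : run.updatedPair K M i ω = run.pair (run.source K M i ω) ω := rfl

theorem mem_updates {t i : ℕ} {x : S × A} :
    i ∈ run.updates K M t ω x ↔ i < t ∧ run.pair (run.source K M i ω) ω = x := by
  simp only [updates, Finset.mem_filter, Finset.mem_range]
  rfl

theorem mem_visits {t j : ℕ} {x : S × A} :
    j ∈ run.visits K M t ω x ↔ j < t ∧ IsOnline K M j ∧ run.pair j ω = x := by
  simp [visits, mem_memory, and_assoc]

theorem source_of_online {i : ℕ} (hi : IsOnline K M i) : run.source K M i ω = i := by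
  simp [source, hi]

theorem visits_subset_updates (t : ℕ) (x : S × A) :
    run.visits K M t ω x ⊆ run.updates K M t ω x := by
  intro j hj
  rw [mem_visits] at hj
  rw [mem_updates, source_of_online hj.2.1]
  exact ⟨hj.1, hj.2.2⟩

theorem updates_succ_of_eq {t : ℕ} {x : S × A} (h : run.updatedPair K M t ω = x) :
    run.updates K M (t + 1) ω x = insert t (run.updates K M t ω x) := by
  classical
  simp only [updates, Finset.range_add_one, Finset.filter_insert, h, if_true]

theorem updates_succ_of_ne {t : ℕ} {x : S × A} (h : run.updatedPair K M t ω ≠ x) :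
    run.updates K M (t + 1) ω x = run.updates K M t ω x := by
  classical
  simp only [updates, Finset.range_add_one, Finset.filter_insert, h, if_false]

theorem notMem_updates_self (t : ℕ) (x : S × A) : t ∉ run.updates K M t ω x := by
  simp [mem_updates]

/-- With the learning rate `1 / n` the estimate is the plain average of all its targets: the first
update erases the initial value. -/
theorem card_mul_qValue (Q₀ : S × A → ℝ) (t : ℕ) (x : S × A) :
    (run.updates K M t ω x).card * run.qValue K M γ Q₀ t ω x
      = ∑ i ∈ run.updates K M t ω x, (run.reward (run.source K M i ω) ω
          + γ * ⨆ a', run.qValue K M γ Q₀ i ω (run.state (run.source K M i ω + 1) ω, a')) := by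
  induction t with
  | zero => simp [updates]
  | succ t ih =>
    by_cases h : run.updatedPair K M t ω = x
    · have hc : run.updateCount K M t ω x = (run.updates K M t ω x).card + 1 := by
        rw [← Finset.card_insert_of_notMem (notMem_updates_self t x), ← updates_succ_of_eq h]
        rfl
      have hn : ((run.updates K M t ω x).card : ℝ) + 1 ≠ 0 := by positivity
      rw [updates_succ_of_eq h, Finset.sum_insert (notMem_updates_self t x), ← ih,
        Finset.card_insert_of_notMem (notMem_updates_self t x), qValue]
      simp only [h, if_true, hc]
      push_cast
      field_simp
      ring
    · rw [updates_succ_of_ne h, ← ih, qValue]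
      simp [h]

theorem abs_qValue_le [Finite A] [Nonempty A] {Q₀ : S × A → ℝ} {R B : ℝ} (hγ : 0 ≤ γ)
    (hR : ∀ i, |run.reward (run.source K M i ω) ω| ≤ R) (hB : R + γ * B ≤ B)
    (hQ : ∀ x, |Q₀ x| ≤ B) (t : ℕ) (x : S × A) : |run.qValue K M γ Q₀ t ω x| ≤ B := by
  induction t generalizing x with
  | zero => exact hQ x
  | succ t ih =>
    obtain ⟨α, hα0, hα1, hstep⟩ : ∃ α : ℝ, 0 ≤ α ∧ α ≤ 1 ∧ run.qValue K M γ Q₀ (t + 1) ω x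
        = (1 - α) * run.qValue K M γ Q₀ t ω x + α * (run.reward (run.source K M t ω) ω
        + γ * ⨆ a', run.qValue K M γ Q₀ t ω (run.state (run.source K M t ω + 1) ω, a')) := by
      by_cases h : run.updatedPair K M t ω = x
      · refine ⟨1 / (run.updateCount K M t ω x : ℝ), by positivity, ?_, by simp [qValue, h]⟩
        rw [one_div]
        exact Nat.cast_inv_le_one _
      · exact ⟨0, le_rfl, zero_le_one, by simp [qValue, h]⟩
    rw [hstep]
    have h1 := abs_iSup_le
      (f := fun a' => run.qValue K M γ Q₀ t ω (run.state (run.source K M t ω + 1) ω, a'))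
      (C := B) (fun a' => ih _)
    have h2 := hR t
    have h3 := ih x
    have h4 : |run.reward (run.source K M t ω) ω
        + γ * ⨆ a', run.qValue K M γ Q₀ t ω (run.state (run.source K M t ω + 1) ω, a')| ≤ B := by
      refine (abs_add_le _ _).trans (le_trans (add_le_add h2 ?_) hB)
      rw [abs_mul, abs_of_nonneg hγ]
      exact mul_le_mul_of_nonneg_left h1 hγ
    calc _ ≤ |(1 - α) * run.qValue K M γ Q₀ t ω x| + |α * (run.reward (run.source K M t ω) ω
        + γ * ⨆ a', run.qValue K M γ Q₀ t ω (run.state (run.source K M t ω + 1) ω, a'))| :=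
          abs_add_le _ _
      _ ≤ (1 - α) * B + α * B := by
          rw [abs_mul, abs_mul, abs_of_nonneg hα0, abs_of_nonneg (sub_nonneg.2 hα1)]
          exact add_le_add (mul_le_mul_of_nonneg_left h3 (sub_nonneg.2 hα1))
            (mul_le_mul_of_nonneg_left h4 hα0)
      _ = B := by ring

/-- The error at an updated pair is at most `γ` times the average of the errors at the times of its
updates, plus the average of the sampling errors. -/
theorem abs_qValue_sub_le [Fintype S] [Fintype A] [Nonempty A] {Q₀ q : S × A → ℝ} (hγ : 0 ≤ γ)
    {t : ℕ} {x : S × A} (hn : 1 ≤ (run.updates K M t ω x).card) :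
    |run.qValue K M γ Q₀ t ω x - q x|
      ≤ γ * ((∑ i ∈ run.updates K M t ω x, ‖run.qValue K M γ Q₀ i ω - q‖)
          / (run.updates K M t ω x).card)
        + |∑ i ∈ run.updates K M t ω x,
            run.tdNoise γ (fun s => ⨆ a', q (s, a')) q (run.source K M i ω) ω|
          / (run.updates K M t ω x).card := by
  have hpos : (0 : ℝ) < (run.updates K M t ω x).card := by exact_mod_cast hn
  have hid : (run.updates K M t ω x).card * (run.qValue K M γ Q₀ t ω x - q x)
      = ∑ i ∈ run.updates K M t ω x,
          run.tdNoise γ (fun s => ⨆ a', q (s, a')) q (run.source K M i ω) ω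
        + γ * ∑ i ∈ run.updates K M t ω x,
          ((⨆ a', run.qValue K M γ Q₀ i ω (run.state (run.source K M i ω + 1) ω, a'))
            - ⨆ a', q (run.state (run.source K M i ω + 1) ω, a')) := by
    rw [mul_sub, card_mul_qValue, Finset.mul_sum, ← Finset.sum_add_distrib, ← nsmul_eq_mul,
      ← Finset.sum_const, ← Finset.sum_sub_distrib]
    refine Finset.sum_congr rfl fun i hi => ?_
    rw [tdNoise, (mem_updates.1 hi).2]
    ring
  have hbias : |∑ i ∈ run.updates K M t ω x,
      ((⨆ a', run.qValue K M γ Q₀ i ω (run.state (run.source K M i ω + 1) ω, a'))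
        - ⨆ a', q (run.state (run.source K M i ω + 1) ω, a'))|
      ≤ ∑ i ∈ run.updates K M t ω x, ‖run.qValue K M γ Q₀ i ω - q‖ := by
    refine (Finset.abs_sum_le_sum_abs _ _).trans (Finset.sum_le_sum fun i _ => ?_)
    refine abs_iSup_sub_iSup_le fun a' => ?_
    exact norm_le_pi_norm (run.qValue K M γ Q₀ i ω - q) (run.state (run.source K M i ω + 1) ω, a')
  rw [← mul_div_assoc, ← add_div, le_div_iff₀ hpos, mul_comm, ← abs_of_pos hpos, ← abs_mul, hid, add_comm]
  refine (abs_add_le _ _).trans (add_le_add ?_ le_rfl)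
  rw [abs_mul, abs_of_nonneg hγ]
  exact mul_le_mul_of_nonneg_left hbias hγ

/-! ### Counting the visits -/

theorem div_le_card_visits {L : ℕ} {x : S × A}
    (hcov : ∀ t, ∃ i, t ≤ i ∧ i < t + L ∧ IsOnline K M i ∧ run.pair i ω = x) (t : ℕ) :
    t / L ≤ (run.visits K M t ω x).card := by
  have key : ∀ k, k ≤ (run.visits K M (k * L) ω x).card := by
    intro k
    induction k with
    | zero => simp
    | succ k ih =>
      obtain ⟨i, h1, h2, h3, h4⟩ := hcov (k * L)
      have hi : i ∉ run.visits K M (k * L) ω x := fun hmem => by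
        have := (mem_visits.1 hmem).1
        omega
      have hsub : insert i (run.visits K M (k * L) ω x) ⊆ run.visits K M ((k + 1) * L) ω x := by
        intro j hj
        rw [add_mul, one_mul]
        rcases Finset.mem_insert.1 hj with rfl | hj
        · exact mem_visits.2 ⟨h2, h3, h4⟩
        · have := mem_visits.1 hj
          exact mem_visits.2 ⟨by omega, this.2⟩
      have := Finset.card_le_card hsub
      rw [Finset.card_insert_of_notMem hi] at this
      omega
  refine (key (t / L)).trans (Finset.card_le_card fun j hj => ?_)
  have := mem_visits.1 hj
  exact mem_visits.2 ⟨this.1.trans_le (Nat.div_mul_le_self t L), this.2⟩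

theorem sum_range_mul_div (g : ℕ → ℝ) {L : ℕ} (hL : 1 ≤ L) (m : ℕ) :
    ∑ i ∈ Finset.range (m * L), g (i / L) = L * ∑ j ∈ Finset.range m, g j := by
  induction m with
  | zero => simp
  | succ m ih =>
    rw [add_mul, one_mul, Finset.sum_range_add, ih, Finset.sum_range_succ, mul_add]
    congr 1
    rw [Finset.sum_congr rfl (g := fun _ => g m)]
    · simp
    · intro k hk
      rw [mul_comm m L, Nat.mul_add_div hL, Nat.div_eq_of_lt (Finset.mem_range.1 hk), add_zero]

/-! ### Averages of the sampling errors along a sample path -/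

variable {V : S → ℝ} {q : S × A → ℝ}

theorem sum_onlineExponent (lam b : ℝ) (x : S × A) (t : ℕ) :
    ∑ i ∈ Finset.range t, run.onlineExponent K M γ V q lam b x i ω
      = lam * ∑ j ∈ run.visits K M t ω x, run.tdNoise γ V q j ω
        - b ^ 2 * (run.visits K M t ω x).card := by
  classical
  have hv : run.visits K M t ω x
      = (Finset.range t).filter fun i => IsOnline K M i ∧ run.pair i ω = x := by
    ext j
    simp [mem_visits]
  rw [hv, Finset.mul_sum, mul_comm (b ^ 2), ← nsmul_eq_mul, ← Finset.sum_const,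
    ← Finset.sum_sub_distrib, Finset.sum_filter]
  refine Finset.sum_congr rfl fun i _ => ?_
  simp only [onlineExponent]

theorem sum_updateExponent (hmem : ∀ i, ¬ IsOnline K M i → run.replayed i ω ∈ memory K M i)
    (lam b : ℝ) (x : S × A) (t : ℕ) :
    ∑ i ∈ Finset.range t, run.updateExponent K M γ V q lam b x i ω
      = lam * ∑ i ∈ run.updates K M t ω x, (run.tdNoise γ V q (run.source K M i ω) ω
          - if IsOnline K M i then 0 else run.empMean K M γ V q i ω x)
        - b ^ 2 * (run.updates K M t ω x).card := by
  classical
  rw [Finset.mul_sum, mul_comm (b ^ 2), ← nsmul_eq_mul, ← Finset.sum_const,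
    ← Finset.sum_sub_distrib, updates, Finset.sum_filter]
  refine Finset.sum_congr rfl fun i _ => ?_
  by_cases hi : IsOnline K M i
  · simp only [updateExponent, onlineExponent, hi, if_true, true_and, updatedPair_eq,
      source_of_online hi, sub_zero]
  · simp only [updateExponent, hi, if_false, updatedPair_eq, source]
    rw [Finset.sum_eq_single_of_mem _ (hmem i hi)]
    · simp
    · intro j _ hj
      simp [hj.symm]

/-- If the exponential supermartingales stay below `exp p`, then the average of the sampling errors
over all the updates at `x` is at most `w` from some number of updates on. -/
theorem abs_sum_tdNoise_le {x : S × A} {w σ p : ℝ} {L m t : ℕ} (hw : 0 < w) (hwσ : w ≤ σ)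
    (hp : 1 ≤ p) (hL : 1 ≤ L)
    (hmem : ∀ i, ¬ IsOnline K M i → run.replayed i ω ∈ memory K M i)
    (hcov : ∀ t, ∃ i, t ≤ i ∧ i < t + L ∧ IsOnline K M i ∧ run.pair i ω = x)
    (hξ : ∀ j, IsOnline K M j → run.pair j ω = x → |run.tdNoise γ V q j ω| ≤ σ)
    (honl : ∀ lam, |lam| = w / (32 * σ ^ 2) → ∀ t,
      ∑ i ∈ Finset.range t, run.onlineExponent K M γ V q lam (w / (16 * σ)) x i ω ≤ p)
    (hupd : ∀ lam, |lam| = w / (32 * σ ^ 2) → ∀ t,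
      ∑ i ∈ Finset.range t, run.updateExponent K M γ V q lam (w / (16 * σ)) x i ω ≤ p)
    (hm : 4096 * (1 + Real.log (σ / w)) * (σ / w) ^ 2 * p ≤ m)
    (hn : m * L ≤ (run.updates K M t ω x).card) :
    |∑ i ∈ run.updates K M t ω x, run.tdNoise γ V q (run.source K M i ω) ω|
      ≤ w * (run.updates K M t ω x).card := by
  have hσ : 0 < σ := hw.trans_le hwσ
  set B := 32 * σ ^ 2 * p / w with hB
  set z := 32 * σ * p / w with hz
  have hs1 : 1 ≤ σ / w := (one_le_div hw).2 hwσ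
  have hz1 : 1 ≤ z := by
    have : z = 32 * (σ / w) * p := by rw [hz]; ring
    rw [this]
    nlinarith
  have hBz : B = σ * z := by rw [hB, hz]; ring
  have hB0 : 0 < B := by rw [hBz]; positivity
  -- A bound `p` on the exponents for both signs of `lam` bounds the absolute value of the sum.
  have habs : ∀ {G N : ℝ}, (∀ lam, |lam| = w / (32 * σ ^ 2) →
      lam * G - (w / (16 * σ)) ^ 2 * N ≤ p) → |G| ≤ B + w / 8 * N := by
    intro G N hGN
    have hl : 0 < w / (32 * σ ^ 2) := by positivity
    have h1 := hGN _ (abs_of_pos hl)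
    have h2 := hGN (-(w / (32 * σ ^ 2))) (by rw [abs_neg, abs_of_pos hl])
    have h3 : w / (32 * σ ^ 2) * (B + w / 8 * N) = p + (w / (16 * σ)) ^ 2 * N := by
      rw [hB]
      field_simp
      ring
    refine abs_le.2 ⟨?_, ?_⟩
    · refine le_of_mul_le_mul_left ?_ hl
      linarith
    · refine le_of_mul_le_mul_left ?_ hl
      linarith
  set f : ℕ → ℝ := fun i => 2 * B * (1 / (z + (i / L : ℕ))) with hf
  have hfanti : Antitone f := by
    intro i j hij
    have h1 : ((i / L : ℕ) : ℝ) ≤ (j / L : ℕ) := by exact_mod_cast Nat.div_le_div_right hij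
    have h2 : (0 : ℝ) ≤ (i / L : ℕ) := Nat.cast_nonneg _
    simp only [hf]
    gcongr
  have hmean : ∀ i, |run.empMean K M γ V q i ω x| ≤ w / 8 + f i := by
    intro i
    have hfi : 0 ≤ f i := by simp only [hf]; positivity
    set N := (run.visits K M i ω x).card with hN
    rcases Nat.eq_zero_or_pos N with h0 | h0
    · have : run.visits K M i ω x = ∅ := Finset.card_eq_zero.1 h0
      rw [empMean, this]
      simp
      positivity
    have hNpos : (0 : ℝ) < N := by exact_mod_cast h0
    have h1 := habs (G := ∑ j ∈ run.visits K M i ω x, run.tdNoise γ V q j ω) (N := N)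
      (fun lam hlam => by
        have := honl lam hlam i
        rwa [sum_onlineExponent] at this)
    have h2 : |∑ j ∈ run.visits K M i ω x, run.tdNoise γ V q j ω| ≤ N * σ := by
      refine (Finset.abs_sum_le_sum_abs _ _).trans ?_
      have := Finset.sum_le_card_nsmul (run.visits K M i ω x)
        (fun j => |run.tdNoise γ V q j ω|) σ (fun j hj => by
          have := mem_visits.1 hj
          exact hξ j this.2.1 this.2.2)
      rwa [nsmul_eq_mul] at this
    have h3 : 2 * B * (1 / (z + N)) ≤ f i := by
      have : ((i / L : ℕ) : ℝ) ≤ N := by exact_mod_cast div_le_card_visits hcov i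
      simp only [hf]
      gcongr
    refine le_trans ?_ (add_le_add le_rfl h3)
    rw [empMean, abs_div, ← hN, abs_of_pos hNpos, div_le_iff₀ hNpos]
    rcases le_total (N : ℝ) z with hNz | hNz
    · have h4 : σ ≤ 2 * B * (1 / (z + N)) := by
        rw [mul_one_div, le_div_iff₀ (by positivity), hBz]
        nlinarith
      nlinarith
    · have h4 : B ≤ 2 * B * (1 / (z + N)) * N := by
        rw [mul_one_div, div_mul_eq_mul_div, le_div_iff₀ (by positivity)]
        nlinarith
      linarith
  set U := run.updates K M t ω x with hU
  have hl0 : 0 ≤ Real.log (σ / w) := Real.log_nonneg hs1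
  have hmB : 128 * (1 + Real.log (σ / w)) * B ≤ m * w := by
    have h1 := mul_le_mul_of_nonneg_right hm hw.le
    have h2 : 4096 * (1 + Real.log (σ / w)) * (σ / w) ^ 2 * p * w
        = 128 * (1 + Real.log (σ / w)) * B := by
      rw [hB]; field_simp; ring
    linarith
  have hm0 : (0 : ℝ) < m := by
    have : 0 < 128 * (1 + Real.log (σ / w)) * B := by positivity
    by_contra hneg
    have : (m : ℝ) * w ≤ 0 := mul_nonpos_of_nonpos_of_nonneg (not_lt.1 hneg) hw.le
    linarith
  have hm1 : 1 ≤ m := by exact_mod_cast hm0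
  have hmL : 1 ≤ m * L := Nat.mul_pos hm1 hL
  have hUpos : (0 : ℝ) < U.card := by exact_mod_cast hmL.trans hn
  have hmU : (m : ℝ) ≤ U.card := by exact_mod_cast (Nat.le_mul_of_pos_right m hL).trans hn
  have hfsum : ∑ i ∈ U, f i ≤ w / 2 * U.card := by
    have h1 := sum_div_card_le hfanti hmL hn
    have h2 : ∑ i ∈ Finset.range (m * L), f i
        = L * (2 * B * ∑ j ∈ Finset.range m, 1 / (z + (j : ℕ))) :=
      (sum_range_mul_div (fun j => 2 * B * (1 / (z + (j : ℕ)))) hL m).trans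
        (by rw [← Finset.mul_sum])
    rw [h2] at h1
    have h3 := sum_inv_add_le_log hz1 m
    have h4 := eight_mul_log_le (q := m * w / B) (s := σ / w) hs1
      ((le_div_iff₀ hB0).2 hmB)
    have h5 : m * w / B * (σ / w) = m / z := by rw [hBz]; field_simp
    rw [h5, le_div_iff₀ hB0] at h4
    have hL0 : (0 : ℝ) < L := by exact_mod_cast hL
    have h6 : (L * (2 * B * ∑ j ∈ Finset.range m, 1 / (z + (j : ℕ)))) / ((m * L : ℕ) : ℝ)
        ≤ w / 2 := by
      rw [div_le_iff₀ (by exact_mod_cast hmL)]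
      push_cast
      have h7 : 2 * B * ∑ j ∈ Finset.range m, 1 / (z + (j : ℕ)) ≤ w / 2 * m := by
        have := mul_le_mul_of_nonneg_left h3 (by positivity : 0 ≤ 2 * B)
        linarith
      have := mul_le_mul_of_nonneg_left h7 hL0.le
      linarith
    exact (div_le_iff₀ hUpos).1 (h1.trans h6)
  have hS := habs (N := U.card)
    (G := ∑ i ∈ U, (run.tdNoise γ V q (run.source K M i ω) ω
      - if IsOnline K M i then 0 else run.empMean K M γ V q i ω x))
    (fun lam hlam => by
      have := hupd lam hlam t
      rwa [sum_updateExponent hmem] at this)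
  have hbias : |∑ i ∈ U, (if IsOnline K M i then 0 else run.empMean K M γ V q i ω x)|
      ≤ w / 8 * U.card + ∑ i ∈ U, f i := by
    calc _ ≤ ∑ i ∈ U, |if IsOnline K M i then 0 else run.empMean K M γ V q i ω x| :=
          Finset.abs_sum_le_sum_abs _ _
      _ ≤ ∑ i ∈ U, (w / 8 + f i) := by
          refine Finset.sum_le_sum fun i _ => ?_
          split_ifs
          · have : 0 ≤ f i := by simp only [hf]; positivity
            simp
            positivity
          · exact hmean i
      _ = _ := by rw [Finset.sum_add_distrib, Finset.sum_const, nsmul_eq_mul]; ring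
  have hBU : B ≤ w / 128 * U.card := by nlinarith
  rw [Finset.sum_sub_distrib] at hS
  have htri := abs_sub_abs_le_abs_sub (∑ i ∈ U, run.tdNoise γ V q (run.source K M i ω) ω)
    (∑ i ∈ U, (if IsOnline K M i then 0 else run.empMean K M γ V q i ω x))
  have hwU : 0 < w * U.card := by positivity
  linarith

end Path

/-! ### The error bound with high probability -/

theorem norm_qValue_sub_le_of_noise {S A Ω : Type*} [Fintype S] [Fintype A] [Nonempty A]
    {run : Run S A Ω} {K M : ℕ} {γ ε D ζ u : ℝ} {a ℓ T₁ k : ℕ}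
    {Q₀ q : S × A → ℝ} {ω : Ω} (hγ : 0 < γ) (hγ1 : γ < 1) (ha : 1 ≤ a) (hℓ : 1 ≤ ℓ)
    (hT₁ : ℓ ≤ T₁) (hε : 0 < ε) (hεD : ε ≤ D) (hζ : 0 < ζ) (hζ1 : ζ < 1)
    (hu : u = Real.log (D / ε) / (1 - γ)) (hk : u / (1 - ζ) ≤ 1 + k * ((a - 1) / a : ℝ))
    (hD : ∀ t, ‖run.qValue K M γ Q₀ t ω - q‖ ≤ D)
    (hcount : ∀ t x, t / ℓ ≤ (run.updates K M t ω x).card)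
    (hnoise : ∀ t, T₁ ≤ t → ∀ x, |∑ i ∈ run.updates K M t ω x,
        run.tdNoise γ (fun s => ⨆ a', q (s, a')) q (run.source K M i ω) ω|
      ≤ (1 - γ) * (ζ * ε) * (run.updates K M t ω x).card) :
    ∀ t, T₁ * (a * ℓ) ^ k ≤ t → ‖run.qValue K M γ Q₀ t ω - q‖ ≤ ε := by
  have hFD : ζ * ε ≤ D := by nlinarith
  intro t ht
  refine le_trans (phase_contraction (e := fun t => ‖run.qValue K M γ Q₀ t ω - q‖) hγ.le ha hℓ hT₁
    hFD hD (fun t ht E hE heE n hn hnt => ?_) k t ht) (phases_suffice hγ hγ1 ha hε hεD hζ hζ1 hu hk)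
  have hE0 : ∀ i, 0 ≤ E i := fun i => (norm_nonneg _).trans (heE i)
  have hnoneg : 0 ≤ γ * ((∑ i ∈ Finset.range n, E i) / n) + (1 - γ) * (ζ * ε) := by
    have h1 : 0 ≤ ∑ i ∈ Finset.range n, E i := Finset.sum_nonneg fun i _ => hE0 i
    have h2 : 0 < 1 - γ := sub_pos.2 hγ1
    positivity
  refine (pi_norm_le_iff_of_nonneg hnoneg).2 fun x => ?_
  have hnU : n ≤ (run.updates K M t ω x).card :=
    ((Nat.le_div_iff_mul_le hℓ).2 hnt).trans (hcount t x)
  have hU : 1 ≤ (run.updates K M t ω x).card := hn.trans hnU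
  have hpos : (0 : ℝ) < (run.updates K M t ω x).card := by exact_mod_cast hU
  refine (abs_qValue_sub_le hγ.le hU).trans (add_le_add ?_ ?_)
  · refine mul_le_mul_of_nonneg_left ?_ hγ.le
    refine le_trans ?_ (sum_div_card_le hE hn hnU)
    gcongr with i _
    exact heE i
  · exact (div_le_iff₀ hpos).2 (hnoise t ht x)

section Event

variable {S A Ω : Type*} [Fintype S] [MeasurableSpace S] [DiscreteMeasurableSpace S] [Fintype A]
  [MeasurableSpace A] [DiscreteMeasurableSpace A] {mΩ : MeasurableSpace Ω}
  {m : MDP S A} {K M : ℕ} {μ : Measure Ω} [IsProbabilityMeasure μ] {ℱ : Filtration ℕ mΩ}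
  {run : Run S A Ω}

/-- A union bound over the pairs, both signs of `lam` and both supermartingales. -/
theorem exists_exponents_le (h : run.IsReplayQLearning m K M μ ℱ) (hK : 1 ≤ K)
    {γ Rmax w σ : ℝ} {V : S → ℝ} {q : S × A → ℝ} (hR : m.RewardBounded Rmax)
    (hσ : ∀ x : S × A, ∀ z : S × ℝ, |z.2| ≤ Rmax → |z.2 + γ * V z.1 - q x| ≤ σ)
    (hmean : ∀ x : S × A, ∫ z, (z.2 + γ * V z.1 - q x) ∂(m.outcome x.1 x.2) = 0)
    (hw : 0 < w) (hwσ : w ≤ σ) (p : ℝ) :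
    ∃ N : Set Ω, μ N ≤ ENNReal.ofReal (4 * (Fintype.card S * Fintype.card A) * Real.exp (-p)) ∧
      ∀ ω ∉ N, ∀ x : S × A, ∀ lam, |lam| = w / (32 * σ ^ 2) → ∀ t,
        ∑ i ∈ Finset.range t, run.onlineExponent K M γ V q lam (w / (16 * σ)) x i ω ≤ p ∧
        ∑ i ∈ Finset.range t, run.updateExponent K M γ V q lam (w / (16 * σ)) x i ω ≤ p := by
  have hσ0 : 0 < σ := hw.trans_le hwσ
  set b := w / (16 * σ) with hb
  have hb1 : b ≤ 1 := by
    rw [hb, div_le_one (by positivity)]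
    linarith
  set c := w / (32 * σ ^ 2) with hc
  have hc0 : 0 < c := by positivity
  have hcb : c * (2 * σ) = b := by rw [hb, hc]; field_simp; norm_num
  set F : ℝ → S × A → Set Ω := fun lam x =>
    {ω | ∃ t, p ≤ ∑ i ∈ Finset.range t, run.onlineExponent K M γ V q lam b x i ω} ∪
    {ω | ∃ t, p ≤ ∑ i ∈ Finset.range t, run.updateExponent K M γ V q lam b x i ω} with hF
  have hFle : ∀ lam, |lam| = c → ∀ x, μ (F lam x) ≤ 2 * ENNReal.ofReal (Real.exp (-p)) := by
    intro lam hlam x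
    rw [two_mul]
    refine (measure_union_le _ _).trans (add_le_add ?_ ?_)
    · refine measure_exists_le_sum_le ℱ (h.onlineExponent_measurable lam b x) (fun t E hE => ?_) p
      refine h.setLIntegral_exp_onlineExponent_le hR (hσ x) (hmean x) ?_ hb1 t hE
      rw [hlam, ← hcb]
      nlinarith
    · refine measure_exists_le_sum_le ℱ (h.updateExponent_measurable lam b x) (fun t E hE => ?_) p
      refine h.setLIntegral_exp_updateExponent_le hK hR (hσ x) (hmean x) ?_ hb1 hσ0.le t hE
      rw [hlam, hcb]
  refine ⟨⋃ x, (F c x ∪ F (-c) x), ?_, ?_⟩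
  · calc μ (⋃ x, (F c x ∪ F (-c) x)) ≤ ∑ x, μ (F c x ∪ F (-c) x) := measure_iUnion_fintype_le _ _
      _ ≤ ∑ _x : S × A, 4 * ENNReal.ofReal (Real.exp (-p)) := by
          refine Finset.sum_le_sum fun x _ => (measure_union_le _ _).trans ?_
          refine (add_le_add (hFle c (abs_of_pos hc0) x)
            (hFle (-c) (by rw [abs_neg, abs_of_pos hc0]) x)).trans (le_of_eq ?_)
          ring
      _ = _ := by
          rw [Finset.sum_const, Finset.card_univ, Fintype.card_prod, nsmul_eq_mul,
            ENNReal.ofReal_mul (by positivity), ENNReal.ofReal_mul (by positivity),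
            ENNReal.ofReal_mul (by positivity)]
          simp
          ring
  · intro ω hω x lam hlam t
    have hnot : ω ∉ F lam x := by
      intro hmem
      refine hω (Set.mem_iUnion.2 ⟨x, ?_⟩)
      rcases eq_or_eq_neg_of_abs_eq hlam with rfl | rfl
      exacts [Or.inl hmem, Or.inr hmem]
    constructor
    · by_contra hcon
      exact hnot (Or.inl ⟨t, (not_le.1 hcon).le⟩)
    · by_contra hcon
      exact hnot (Or.inr ⟨t, (not_le.1 hcon).le⟩)

theorem one_sub_le_measure_of_ae {β : ℝ} (hβ : 0 ≤ β) {N G : Set Ω}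
    (hN : μ N ≤ ENNReal.ofReal β) (hG : ∀ᵐ ω ∂μ, ω ∉ N → ω ∈ G) :
    ENNReal.ofReal (1 - β) ≤ μ G := by
  have h1 : (1 : ℝ≥0∞) ≤ μ G + μ N := by
    rw [← measure_univ (μ := μ)]
    refine le_trans (measure_mono_ae ?_) (measure_union_le G N)
    filter_upwards [hG] with ω hω _
    by_cases hN' : ω ∈ N
    exacts [Or.inr hN', Or.inl (hω hN')]
  rw [ENNReal.ofReal_sub _ hβ, ENNReal.ofReal_one, tsub_le_iff_right]
  exact h1.trans (add_le_add le_rfl hN)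

variable [Nonempty S] [Nonempty A] {γ Rmax : ℝ} {Q₀ : S × A → ℝ}

theorem ae_norm_qValue_sub_le_initDist (h : run.IsReplayQLearning m K M μ ℱ) (hK : 1 ≤ K)
    (hR : m.RewardBounded Rmax) (hγ : 0 < γ) (hγ1 : γ < 1) :
    ∀ᵐ ω ∂μ, ∀ t, ‖run.qValue K M γ Q₀ t ω - m.optQ γ‖ ≤ initDist Rmax γ Q₀ := by
  have hR0 := MDP.RewardBounded.nonneg hR
  have h1γ : 0 < 1 - γ := sub_pos.2 hγ1
  have hV0 : 0 ≤ vMax Rmax γ := div_nonneg hR0 h1γ.le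
  have hRV : Rmax = (1 - γ) * vMax Rmax γ := by rw [vMax]; field_simp
  filter_upwards [h.ae_abs_reward_le hR, h.ae_replayed_mem hK] with ω hω1 hω2 t
  have hsrc : ∀ i, |run.reward (run.source K M i ω) ω| ≤ Rmax := by
    intro i
    by_cases hi : IsOnline K M i
    · rw [source_of_online hi]
      exact hω1 i hi
    · simp only [source, hi, if_false]
      exact hω1 _ (mem_memory.1 (hω2 i hi)).2
  have hD0 : 0 ≤ initDist Rmax γ Q₀ := by
    have : vMax Rmax γ ≤ max ‖Q₀‖ (vMax Rmax γ) := le_max_right _ _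
    rw [initDist]
    linarith
  refine (pi_norm_le_iff_of_nonneg hD0).2 fun x => ?_
  have h1 := abs_qValue_le (run := run) (K := K) (M := M) (ω := ω) (Q₀ := Q₀)
    (B := max ‖Q₀‖ (vMax Rmax γ)) hγ.le hsrc (by
      have : vMax Rmax γ ≤ max ‖Q₀‖ (vMax Rmax γ) := le_max_right _ _
      have := mul_le_mul_of_nonneg_left this h1γ.le
      linarith) (fun x => (norm_le_pi_norm Q₀ x).trans (le_max_left _ _)) t x
  have h2 := MDP.abs_optQ_le hR hγ.le hγ1 x
  rw [Pi.sub_apply, Real.norm_eq_abs, initDist]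
  refine (abs_sub _ _).trans ?_
  linarith

/-- The error is at most `ε` after the sampling errors have been averaged up to time `T₁` and `k`
further phases of contraction have passed. -/
theorem one_sub_le_measure_qValue (h : run.IsReplayQLearning m K M μ ℱ) (hK : 1 ≤ K)
    (hR : m.RewardBounded Rmax) (hγ : 0 < γ) (hγ1 : γ < 1) {ε ζ u σ p : ℝ} {a ℓ T₁ k L n : ℕ}
    (ha : 1 ≤ a) (hℓ : 1 ≤ ℓ) (hL : 1 ≤ L) (hT₁ : ℓ ≤ T₁) (hε : 0 < ε)
    (hεD : ε ≤ initDist Rmax γ Q₀) (hζ : 0 < ζ) (hζ1 : ζ < 1)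
    (hu : u = Real.log (initDist Rmax γ Q₀ / ε) / (1 - γ))
    (hk : u / (1 - ζ) ≤ 1 + k * ((a - 1) / a : ℝ))
    (hσ : ∀ x : S × A, ∀ z : S × ℝ, |z.2| ≤ Rmax →
      |z.2 + γ * (fun s => ⨆ a', m.optQ γ (s, a')) z.1 - m.optQ γ x| ≤ σ)
    (hp : 1 ≤ p)
    (hcov : ∀ᵐ ω ∂μ, ∀ x t, ∃ i, t ≤ i ∧ i < t + L ∧ IsOnline K M i ∧ run.pair i ω = x)
    (hcount : ∀ᵐ ω ∂μ, ∀ t x, t / ℓ ≤ (run.updates K M t ω x).card)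
    (hnoise : σ ≤ (1 - γ) * (ζ * ε) ∨ ((1 - γ) * (ζ * ε) ≤ σ ∧
      4096 * (1 + Real.log (σ / ((1 - γ) * (ζ * ε)))) * (σ / ((1 - γ) * (ζ * ε))) ^ 2 * p ≤ n ∧
      n * L * ℓ ≤ T₁)) :
    ENNReal.ofReal (1 - 4 * (Fintype.card S * Fintype.card A) * Real.exp (-p)) ≤
      μ {ω | ∀ t : ℕ, T₁ * (a * ℓ) ^ k ≤ t → ‖run.qValue K M γ Q₀ t ω - m.optQ γ‖ ≤ ε} := by
  have hw : 0 < (1 - γ) * (ζ * ε) := mul_pos (sub_pos.2 hγ1) (mul_pos hζ hε)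
  set w := (1 - γ) * (ζ * ε) with hwdef
  have hβ : 0 ≤ 4 * ((Fintype.card S : ℝ) * Fintype.card A) * Real.exp (-p) := by positivity
  have hξ : ∀ᵐ ω ∂μ, ∀ j, IsOnline K M j →
      |run.tdNoise γ (fun s => ⨆ a', m.optQ γ (s, a')) (m.optQ γ) j ω| ≤ σ := by
    filter_upwards [h.ae_abs_reward_le hR] with ω hω j hj
    exact hσ (run.pair j ω) (run.state (j + 1) ω, run.reward j ω) (hω j hj)
  have hbd := ae_norm_qValue_sub_le_initDist (Q₀ := Q₀) h hK hR hγ hγ1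
  have hmem := h.ae_replayed_mem hK
  rcases hnoise with hsmall | ⟨hwσ, hn, hnT⟩
  · refine one_sub_le_measure_of_ae (N := ∅) hβ (by simp) ?_
    filter_upwards [hbd, hcount, hξ, hmem] with ω h1 h2 h3 h4 _
    refine norm_qValue_sub_le_of_noise hγ hγ1 ha hℓ hT₁ hε hεD hζ hζ1 hu hk h1 h2 ?_
    intro t _ x
    refine (Finset.abs_sum_le_sum_abs _ _).trans ?_
    -- Here the sampling errors are below the noise level even without averaging.
    have := Finset.sum_le_card_nsmul (run.updates K M t ω x) (fun i =>
      |run.tdNoise γ (fun s => ⨆ a', m.optQ γ (s, a')) (m.optQ γ) (run.source K M i ω) ω|) w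
      (fun i _ => by
        by_cases hi : IsOnline K M i
        · rw [source_of_online hi]
          exact (h3 i hi).trans hsmall
        · simp only [source, hi, if_false]
          exact (h3 _ (mem_memory.1 (h4 i hi)).2).trans hsmall)
    rw [nsmul_eq_mul] at this
    linarith
  · obtain ⟨N, hN, hNgood⟩ := exists_exponents_le (V := fun s => ⨆ a', m.optQ γ (s, a'))
      (q := m.optQ γ) h hK hR hσ
      (MDP.integral_tdError_eq_zero hR hγ.le hγ1) hw hwσ p
    refine one_sub_le_measure_of_ae hβ hN ?_
    filter_upwards [hbd, hcount, hξ, hmem, hcov] with ω h1 h2 h3 h4 h5 hωN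
    refine norm_qValue_sub_le_of_noise hγ hγ1 ha hℓ hT₁ hε hεD hζ hζ1 hu hk h1 h2 ?_
    intro t ht x
    refine abs_sum_tdNoise_le hw hwσ hp hL h4 (h5 x) (fun j hj _ => h3 j hj)
      (fun lam hlam s => (hNgood ω hωN x lam hlam s).1)
      (fun lam hlam s => (hNgood ω hωN x lam hlam s).2) hn ?_
    exact ((Nat.le_div_iff_mul_le hℓ).2 (hnT.trans ht)).trans (h2 t x)

end Event

end Run

/-! ### The number of phases against the time bound -/

/-- The noise level `ζ ε` and the number `k` of phases with growth factor `3 L`, for `y = 3 n / c`.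
The level `ζ` has to be small only where `u` is just below `1`: there one phase has to suffice,
since `y ^ (2 u)` is too small for a second one. -/
theorem exists_phases {y u : ℝ} (hy : 6 ≤ y) :
    ∃ (k : ℕ) (ζ : ℝ), 0 < ζ ∧ ζ < 1 ∧ u / (1 - ζ) ≤ 1 + k * (2 / 3 : ℝ) ∧
      (1 / ζ) ^ 2 * (1 + Real.log (1 / ζ) + u) * y ^ (k + 1) ≤ 20000 * y ^ (max 1 (2 * u)) := by
  have hy0 : 0 < y := by linarith
  have hy1 : 1 ≤ y := by linarith
  have hlog10 : Real.log (1 / (1 / 10)) ≤ 9 := by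
    have := Real.log_le_sub_one_of_pos (show (0 : ℝ) < 1 / (1 / 10) by norm_num)
    linarith
  rcases le_or_gt u (9 / 10) with h1 | h1
  · refine ⟨0, 1 / 10, by norm_num, by norm_num, ?_, ?_⟩
    · rw [div_le_iff₀ (by norm_num)]
      norm_num
      linarith
    · have h2 : y ≤ y ^ (max 1 (2 * u)) := by
        conv_lhs => rw [← Real.rpow_one y]
        exact Real.rpow_le_rpow_of_exponent_le hy1 (le_max_left _ _)
      rw [zero_add, pow_one]
      have h3 : (1 / (1 / 10 : ℝ)) ^ 2 * (1 + Real.log (1 / (1 / 10)) + u) ≤ 20000 := by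
        norm_num at hlog10 ⊢
        linarith
      exact mul_le_mul h3 h2 hy0.le (by norm_num)
  have hmax : max 1 (2 * u) = 2 * u := max_eq_right (by linarith)
  rw [hmax]
  rcases le_or_gt u (1 - 1 / Real.log y) with h2 | h2
  · have hly : 1 < Real.log y := by
      by_contra hcon
      rcases le_or_gt (Real.log y) 0 with h0 | h0
      · exact absurd (Real.log_pos (by linarith : 1 < y)) (not_lt.2 h0)
      · have : 1 ≤ 1 / Real.log y := (one_le_div h0).2 (not_lt.1 hcon)
        linarith
    have hl0 : 0 < Real.log y := by linarith
    refine ⟨0, 1 / Real.log y, by positivity, ?_, ?_, ?_⟩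
    · rw [div_lt_one hl0]; exact hly
    · rw [div_le_iff₀ (by linarith)]
      simpa using h2
    · rw [zero_add, pow_one, one_div_one_div]
      have hll : Real.log (Real.log y) ≤ Real.log y := by
        have := Real.log_le_sub_one_of_pos hl0
        linarith
      have hu1 : u ≤ 1 := by
        have : 0 < 1 / Real.log y := by positivity
        linarith
      have h3 : Real.log y ^ 2 * (1 + Real.log (Real.log y) + u) ≤ 3 * Real.log y ^ 3 := by
        have : 1 + Real.log (Real.log y) + u ≤ 3 * Real.log y := by linarith
        calc _ ≤ Real.log y ^ 2 * (3 * Real.log y) := by gcongr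
          _ = _ := by ring
      have h4 : Real.log y ≤ 5 * y ^ (1 / 5 : ℝ) := by
        have := Real.log_le_rpow_div hy0.le (show (0 : ℝ) < 1 / 5 by norm_num)
        linarith
      have h5 : Real.log y ^ 3 ≤ 125 * y ^ (3 / 5 : ℝ) := by
        calc Real.log y ^ 3 ≤ (5 * y ^ (1 / 5 : ℝ)) ^ 3 := by gcongr
          _ = 125 * y ^ (3 / 5 : ℝ) := by
              rw [mul_pow, ← Real.rpow_natCast (y ^ (1 / 5 : ℝ)) 3, ← Real.rpow_mul hy0.le]
              norm_num
      calc _ ≤ 375 * y ^ (3 / 5 : ℝ) * y :=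
            mul_le_mul_of_nonneg_right (by linarith) hy0.le
        _ = 375 * y ^ (3 / 5 + 1 : ℝ) := by rw [mul_assoc, Real.rpow_add hy0, Real.rpow_one]
        _ ≤ 20000 * y ^ (2 * u) := by
            gcongr
            · norm_num
            · linarith
  · set k := ⌈3 / 2 * (u / (9 / 10) - 1)⌉₊ with hk
    have hzpos : 0 < 3 / 2 * (u / (9 / 10) - 1) := by
      have : 1 < u / (9 / 10) := (one_lt_div (by norm_num)).2 h1
      linarith
    have hk1 : 3 / 2 * (u / (9 / 10) - 1) ≤ k := Nat.le_ceil _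
    have hk2 : (k : ℝ) < 3 / 2 * (u / (9 / 10) - 1) + 1 := Nat.ceil_lt_add_one hzpos.le
    refine ⟨k, 1 / 10, by norm_num, by norm_num, ?_, ?_⟩
    · norm_num at hk1 ⊢
      linarith
    · have h3 : (1 / (1 / 10 : ℝ)) ^ 2 * (1 + Real.log (1 / (1 / 10)) + u) ≤ 100 * (10 + u) := by
        norm_num at hlog10 ⊢
        linarith
      have hkey : (10 + u) * y ^ (k + 1) ≤ 200 * y ^ (2 * u) := by
        rw [← Real.rpow_natCast]
        rcases le_or_gt u (3 / 2) with h4 | h4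
        · have hkle : k ≤ 1 := by
            rw [hk]
            refine Nat.ceil_le.2 ?_
            norm_num
            linarith
          have h5 : y ^ ((k + 1 : ℕ) : ℝ) ≤ y ^ (2 : ℝ) := by
            refine Real.rpow_le_rpow_of_exponent_le hy1 ?_
            have : (k : ℝ) ≤ 1 := by exact_mod_cast hkle
            push_cast
            linarith
          have h6 : y ^ (2 : ℝ) ≤ Real.exp 2 * y ^ (2 * u) := by
            have hl0 : 0 < Real.log y := Real.log_pos (by linarith)
            rw [Real.rpow_def_of_pos hy0, Real.rpow_def_of_pos hy0, ← Real.exp_add]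
            refine Real.exp_le_exp.2 ?_
            have := mul_lt_mul_of_pos_left h2 hl0
            rw [mul_sub, mul_one_div_cancel hl0.ne'] at this
            linarith
          have h7 : Real.exp 2 ≤ 9 := by
            have : Real.exp 2 = Real.exp 1 * Real.exp 1 := by rw [← Real.exp_add]; norm_num
            have := Real.exp_one_lt_d9
            have := Real.exp_pos 1
            nlinarith
          have h8 : 0 < y ^ (2 * u) := by positivity
          calc (10 + u) * y ^ ((k + 1 : ℕ) : ℝ) ≤ 12 * (Real.exp 2 * y ^ (2 * u)) := by
                refine mul_le_mul (by linarith) (h5.trans h6) (by positivity) (by norm_num)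
            _ ≤ 12 * (9 * y ^ (2 * u)) := by gcongr
            _ ≤ 200 * y ^ (2 * u) := by linarith
        · have h5 : ((k + 1 : ℕ) : ℝ) ≤ 2 * u - (u / 3 - 1 / 2) := by
            push_cast
            norm_num at hk2
            linarith
          have h6 : 10 + u ≤ 200 * y ^ (u / 3 - 1 / 2) := by
            have hle : Real.exp 1 ≤ y := by linarith [Real.exp_one_lt_d9]
            have h7 : Real.exp (u / 3 - 1 / 2) ≤ y ^ (u / 3 - 1 / 2) := by
              rw [← Real.exp_one_rpow]
              exact Real.rpow_le_rpow (Real.exp_pos 1).le hle (by linarith)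
            have h8 := Real.add_one_le_exp (u / 3 - 1 / 2)
            linarith
          calc (10 + u) * y ^ ((k + 1 : ℕ) : ℝ)
              ≤ 200 * y ^ (u / 3 - 1 / 2) * y ^ (2 * u - (u / 3 - 1 / 2)) := by
                refine mul_le_mul h6 (Real.rpow_le_rpow_of_exponent_le hy1 h5) (by positivity)
                  (by positivity)
            _ = 200 * y ^ (2 * u) := by
                rw [mul_assoc, ← Real.rpow_add hy0]
                ring_nf
      have hyk : 0 ≤ y ^ (k + 1) := by positivity
      calc _ ≤ 100 * (10 + u) * y ^ (k + 1) := by gcongr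
        _ ≤ _ := by linarith

/-- The number `k` of phases with growth factor `2`, which suffice for a single state-action
pair. -/
theorem exists_phases_of_single {y u : ℝ} (hy : 6 ≤ y) (hu : 0 ≤ u) :
    ∃ k : ℕ, u / (1 - 1 / 100) ≤ 1 + k * (1 / 2 : ℝ) ∧
      (6 + u) * Real.exp (2 * u) * 2 ^ k * y ≤ 60 * y ^ (max 1 (2 * u)) := by
  have hy0 : 0 < y := by linarith
  have hk0 : 0 ≤ u / (1 - 1 / 100) := div_nonneg hu (by norm_num)
  have hcu : u / (1 - 1 / 100) = 100 / 99 * u := by ring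
  refine ⟨⌈2 * (u / (1 - 1 / 100) - 1)⌉₊, ?_, ?_⟩
  · have := Nat.le_ceil (2 * (u / (1 - 1 / 100) - 1))
    linarith
  set k := ⌈2 * (u / (1 - 1 / 100) - 1)⌉₊ with hk
  have hkle : (k : ℝ) ≤ 200 / 99 * u := by
    rcases le_or_gt (2 * (u / (1 - 1 / 100) - 1)) 0 with h0 | h0
    · rw [hk, Nat.ceil_eq_zero.2 h0, Nat.cast_zero]
      positivity
    · have := Nat.ceil_lt_add_one h0.le
      rw [← hk] at this
      linarith
  have hl2 := Real.log_two_gt_d9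
  have hl2pos : 0 < Real.log 2 := by linarith
  have hl3 : 19 / 12 * Real.log 2 ≤ Real.log 3 := by
    have h := Real.log_le_log (by norm_num) (show (2 : ℝ) ^ 19 ≤ 3 ^ 12 by norm_num)
    rw [Real.log_pow, Real.log_pow] at h
    push_cast at h
    linarith
  have hl6 : Real.log 6 = Real.log 2 + Real.log 3 := by
    rw [← Real.log_mul (by norm_num) (by norm_num)]; norm_num
  have h1 : 6 + u ≤ 10 * Real.exp (u / 10) := by
    have := Real.add_one_le_exp (u / 10)
    linarith
  have h2 : (2 : ℝ) ^ k ≤ Real.exp (200 / 99 * u * Real.log 2) := by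
    rw [← Real.rpow_natCast, Real.rpow_def_of_pos (by norm_num)]
    refine Real.exp_le_exp.2 ?_
    rw [mul_comm]
    exact mul_le_mul_of_nonneg_right hkle hl2pos.le
  -- The exponents add up to `1 / 10 + 2 + (200 / 99) log 2 < 2 log 6`.
  have h3 : Real.exp (u / 10) * Real.exp (2 * u) * Real.exp (200 / 99 * u * Real.log 2)
      ≤ (6 : ℝ) ^ (2 * u) := by
    rw [← Real.exp_add, ← Real.exp_add, Real.rpow_def_of_pos (by norm_num)]
    refine Real.exp_le_exp.2 ?_
    have h : 1 / 10 + 2 + 200 / 99 * Real.log 2 ≤ 2 * Real.log 6 := by linarith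
    have := mul_le_mul_of_nonneg_left h hu
    linarith
  set e := max 1 (2 * u) with he
  have h4 : (6 : ℝ) ^ (2 * u) ≤ 6 * 6 ^ (e - 1) := by
    calc (6 : ℝ) ^ (2 * u) ≤ 6 ^ e :=
          Real.rpow_le_rpow_of_exponent_le (by norm_num) (le_max_right _ _)
      _ = 6 * 6 ^ (e - 1) := by
          rw [Real.rpow_sub_one (by norm_num)]
          ring
  have h5 : (6 : ℝ) ^ (e - 1) ≤ y ^ (e - 1) :=
    Real.rpow_le_rpow (by norm_num) hy (sub_nonneg.2 (le_max_left _ _))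
  have h6 : y ^ (e - 1) * y = y ^ e := by
    rw [Real.rpow_sub_one hy0.ne']
    field_simp
  calc (6 + u) * Real.exp (2 * u) * 2 ^ k * y
      ≤ 10 * Real.exp (u / 10) * Real.exp (2 * u) * Real.exp (200 / 99 * u * Real.log 2) * y := by
        gcongr
    _ = 10 * (Real.exp (u / 10) * Real.exp (2 * u) * Real.exp (200 / 99 * u * Real.log 2)) * y := by
        ring
    _ ≤ 10 * (6 * y ^ (e - 1)) * y := by
        refine mul_le_mul_of_nonneg_right (mul_le_mul_of_nonneg_left ?_ (by norm_num)) hy0.le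
        exact h3.trans (h4.trans (by gcongr))
    _ = 60 * y ^ e := by rw [← h6]; ring

namespace Run

/-! ### Comparison with the explicit time bound -/

/-- A replay iteration visits no pair, so that the windows have length at least two. -/
theorem two_le_of_covers {S A Ω : Type*} [Fintype S] [Nonempty S] [Fintype A] [Nonempty A]
    {mΩ : MeasurableSpace Ω} {μ : Measure Ω} [IsProbabilityMeasure μ] {K M : ℕ} {c : ℝ}
    {run : Run S A Ω} (hK : 1 ≤ K) (hM : 1 ≤ M) (hcov : run.Covers K M μ c) :
    2 ≤ (Fintype.card S * Fintype.card A : ℝ) / c := by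
  obtain ⟨ω, hω⟩ := hcov.exists
  obtain ⟨i, hi, hi2, honl, -, -⟩ := hω K (Classical.arbitrary S) (Classical.arbitrary A)
  have hne : i ≠ K := by
    rintro rfl
    rw [IsOnline, Nat.mod_eq_of_lt (by omega)] at honl
    omega
  have : (K : ℝ) + 1 ≤ i := by exact_mod_cast (by omega : K + 1 ≤ i)
  linarith

theorem ae_exists_visit {S A Ω : Type*} [Fintype S] [Fintype A] {mΩ : MeasurableSpace Ω}
    {μ : Measure Ω} {K M : ℕ} {c : ℝ} {run : Run S A Ω} (hcov : run.Covers K M μ c) :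
    ∀ᵐ ω ∂μ, ∀ x t, ∃ i, t ≤ i ∧ i < t + ⌊(Fintype.card S * Fintype.card A : ℝ) / c⌋₊ ∧
      IsOnline K M i ∧ run.pair i ω = x := by
  filter_upwards [hcov] with ω hω x t
  obtain ⟨i, hi, hi2, honl, hs, ha⟩ := hω t x.1 x.2
  refine ⟨i, hi, ?_, honl, Prod.ext hs ha⟩
  have : i - t + 1 ≤ ⌊(Fintype.card S * Fintype.card A : ℝ) / c⌋₊ := by
    refine Nat.le_floor ?_
    push_cast [Nat.cast_sub hi]
    linarith
  omega

theorem one_add_log_le_softFactor (γ D ε : ℝ) :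
    1 + Real.log (1 / (1 - γ)) ≤ softFactor γ D ε := by
  have : 0 ≤ Real.log (1 + max 0 (Real.log (D / ε))) :=
    Real.log_nonneg (by linarith [le_max_left 0 (Real.log (D / ε))])
  rw [softFactor]
  linarith

section Bounds

variable {S A Ω : Type*} [Fintype S] [Nonempty S] [MeasurableSpace S] [DiscreteMeasurableSpace S]
  [Fintype A] [Nonempty A] [MeasurableSpace A] [DiscreteMeasurableSpace A]
  {mΩ : MeasurableSpace Ω} {μ : Measure Ω} [IsProbabilityMeasure μ] {ℱ : Filtration ℕ mΩ}
  {m : MDP S A} {Rmax γ c δ ε : ℝ} {K M : ℕ} {Q₀ : S × A → ℝ} {run : Run S A Ω}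

/-- The case in which `log (n / δ)` bounds the logarithm of the number of bad events over `δ`. The
noise is averaged over `n L` updates at every pair, which takes `n L²` iterations. -/
theorem le_measure_of_two_le_div (hR : m.RewardBounded Rmax) (hγ : 0 < γ) (hγ1 : γ < 1)
    (hδ : 0 < δ) (hε : 0 < ε) (hK : 1 ≤ K) (h : run.IsReplayQLearning m K M μ ℱ)
    (hcov : run.Covers K M μ c) {n u T : ℝ} (hn : n = Fintype.card S * Fintype.card A)
    (hn0 : 0 < n) (hc : 0 < c) (hL2 : 2 ≤ n / c) (hnδ : 2 ≤ n / δ)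
    (hεD : ε < initDist Rmax γ Q₀) (hu : u = Real.log (initDist Rmax γ Q₀ / ε) / (1 - γ))
    (hTY : 20000 * (3 * (n / c)) ^ max 1 (2 * u) ≤ T)
    (hTP : 2 * 10 ^ 9 * (1 + Real.log (1 / (1 - γ))) * ((3 * (n / c)) ^ max 1 (2 * u) *
      (n * Rmax ^ 2 * Real.log (n / δ) / (c * (1 - γ) ^ 4 * ε ^ 2))) ≤ T) :
    ENNReal.ofReal (1 - δ) ≤
      μ {ω | ∀ t : ℕ, T ≤ t → ‖run.qValue K M γ Q₀ t ω - m.optQ γ‖ ≤ ε} := by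
  have h1γ : 0 < 1 - γ := sub_pos.2 hγ1
  have hR0 := MDP.RewardBounded.nonneg hR
  set V := vMax Rmax γ with hVdef
  have hV0 : 0 ≤ V := div_nonneg hR0 h1γ.le
  have hRV : Rmax = (1 - γ) * V := by rw [hVdef, vMax]; field_simp
  set D := initDist Rmax γ Q₀ with hD
  have hVD : 2 * V ≤ D := by
    have : V ≤ max ‖Q₀‖ V := le_max_right _ _
    rw [hD, initDist]
    linarith
  have hD0 : 0 < D := hε.trans hεD
  have hcov' := ae_exists_visit hcov
  rw [← hn] at hcov'
  set L := ⌊n / c⌋₊ with hL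
  have hLle : (L : ℝ) ≤ n / c := Nat.floor_le (by linarith)
  have hL1 : 1 ≤ L := by
    refine Nat.le_floor ?_
    push_cast
    linarith
  set y := 3 * (n / c) with hy
  have hy6 : 6 ≤ y := by linarith
  have hy0 : 0 < y := by linarith
  have hu0 : 0 < u := hu ▸ div_pos (Real.log_pos ((one_lt_div hε).2 hεD)) h1γ
  have hlogD : Real.log (D / ε) ≤ u := by
    have : Real.log (D / ε) = (1 - γ) * u := by rw [hu]; field_simp
    rw [this]
    nlinarith
  have hgap : 0 ≤ Real.log (1 / (1 - γ)) :=
    Real.log_nonneg ((one_le_div h1γ).2 (by linarith))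
  have hl2 := Real.log_two_gt_d9
  have hlp : Real.log 2 ≤ Real.log (n / δ) := Real.log_le_log (by norm_num) hnδ
  set p := Real.log (4 * n / δ) with hp
  have hp4 : p = 2 * Real.log 2 + Real.log (n / δ) := by
    rw [hp, mul_div_assoc, Real.log_mul (by norm_num) (by positivity),
      show (4 : ℝ) = 2 ^ 2 by norm_num, Real.log_pow]
    push_cast
    ring
  have hp1 : 1 ≤ p := by linarith
  have hp3 : p ≤ 3 * Real.log (n / δ) := by linarith
  have hprob : 4 * ((Fintype.card S : ℝ) * Fintype.card A) * Real.exp (-p) = δ := by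
    rw [← hn, Real.exp_neg, hp, Real.exp_log (by positivity)]
    field_simp
  have hcount : ∀ᵐ ω ∂μ, ∀ t x, t / L ≤ (run.updates K M t ω x).card := by
    filter_upwards [hcov'] with ω hω t x
    exact (div_le_card_visits (hω x) t).trans (Finset.card_le_card (visits_subset_updates t x))
  have hσ : ∀ x : S × A, ∀ z : S × ℝ, |z.2| ≤ Rmax →
      |z.2 + γ * (fun s => ⨆ a', m.optQ γ (s, a')) z.1 - m.optQ γ x| ≤ 2 * V := by
    intro x z hz
    have h1 : |γ * ⨆ a', m.optQ γ (z.1, a')| ≤ γ * V := by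
      rw [abs_mul, abs_of_pos hγ]
      exact mul_le_mul_of_nonneg_left
        (abs_iSup_le fun a' => MDP.abs_optQ_le hR hγ.le hγ1 _) hγ.le
    have h2 := MDP.abs_optQ_le hR hγ.le hγ1 x
    refine (abs_sub _ _).trans ?_
    have h3 := abs_add_le z.2 (γ * ⨆ a', m.optQ γ (z.1, a'))
    simp only
    linarith
  obtain ⟨k, ζ, hζ, hζ1, hk, hkY⟩ := exists_phases (u := u) hy6
  have hk' : u / (1 - ζ) ≤ 1 + k * (((3 : ℕ) - 1) / (3 : ℕ) : ℝ) := by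
    norm_num at hk ⊢
    exact hk
  have hlogζ : 0 ≤ Real.log (1 / ζ) := Real.log_nonneg ((one_le_div hζ).2 hζ1.le)
  set w := (1 - γ) * (ζ * ε) with hw
  have hw0 : 0 < w := mul_pos h1γ (mul_pos hζ hε)
  set Y := y ^ max 1 (2 * u) with hY
  have hLk : (L : ℝ) * (3 * L) ^ k ≤ y ^ (k + 1) := by
    rw [pow_succ, mul_comm]
    have hL0 : (0 : ℝ) ≤ L := Nat.cast_nonneg L
    gcongr <;> linarith
  rcases le_or_gt (2 * V) w with hsmall | hlarge
  · have hmain := one_sub_le_measure_qValue (Q₀ := Q₀) (p := p) (a := 3) (ℓ := L) (T₁ := L) (n := 0)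
      h hK hR hγ hγ1 (by norm_num) hL1 hL1 le_rfl hε hεD.le hζ hζ1 hu hk' hσ hp1 hcov' hcount
      (Or.inl hsmall)
    rw [hprob] at hmain
    refine hmain.trans (measure_mono fun ω hω t ht => hω t ?_)
    have h1 : y ^ (k + 1) ≤ (1 / ζ) ^ 2 * (1 + Real.log (1 / ζ) + u) * y ^ (k + 1) := by
      refine le_mul_of_one_le_left (by positivity) ?_
      have h2 : 1 ≤ (1 / ζ) ^ 2 := one_le_pow₀ ((one_le_div hζ).2 hζ1.le)
      have h3 : 1 ≤ 1 + Real.log (1 / ζ) + u := by linarith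
      exact one_le_mul_of_one_le_of_one_le h2 h3
    have h4 : (L : ℝ) * (3 * L) ^ k ≤ t := by linarith
    exact_mod_cast h4
  · have hs1 : 1 ≤ 2 * V / w := (one_le_div hw0).2 hlarge.le
    have hls : 0 ≤ Real.log (2 * V / w) := Real.log_nonneg hs1
    set Z := 4096 * (1 + Real.log (2 * V / w)) * (2 * V / w) ^ 2 * p with hZ
    have hZ1 : 1 ≤ Z := by
      have h1 : 1 ≤ (2 * V / w) ^ 2 := one_le_pow₀ hs1
      have h2 : (1 : ℝ) ≤ 4096 * (1 + Real.log (2 * V / w)) := by linarith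
      exact one_le_mul_of_one_le_of_one_le (one_le_mul_of_one_le_of_one_le h2 h1) hp1
    have hN1 : Z ≤ ⌈Z⌉₊ := Nat.le_ceil Z
    have hN2 : (⌈Z⌉₊ : ℝ) ≤ 2 * Z := by
      have := Nat.ceil_lt_add_one (by linarith : 0 ≤ Z)
      linarith
    have hN3 : 1 ≤ ⌈Z⌉₊ := Nat.one_le_ceil_iff.2 (by linarith)
    have hmain := one_sub_le_measure_qValue (Q₀ := Q₀) (p := p) (a := 3) (ℓ := L)
      (T₁ := ⌈Z⌉₊ * L * L) (n := ⌈Z⌉₊)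
      h hK hR hγ hγ1 (by norm_num) hL1 hL1 (Nat.le_mul_of_pos_left _ (Nat.mul_pos hN3 hL1)) hε
      hεD.le hζ hζ1 hu hk' hσ hp1 hcov' hcount (Or.inr ⟨hlarge.le, hN1, le_rfl⟩)
    rw [hprob] at hmain
    refine hmain.trans (measure_mono fun ω hω t ht => hω t ?_)
    have hlog : 1 + Real.log (2 * V / w)
        ≤ (1 + Real.log (1 / (1 - γ))) * (1 + Real.log (1 / ζ) + u) := by
      have h1 : 2 * V / w ≤ D / ε * (1 / (1 - γ)) * (1 / ζ) := by
        have : D / ε * (1 / (1 - γ)) * (1 / ζ) = D / w := by rw [hw]; field_simp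
        rw [this]
        gcongr
      have h2 := Real.log_le_log (by linarith) h1
      rw [Real.log_mul (by positivity) (by positivity),
        Real.log_mul (by positivity) (by positivity)] at h2
      have h3 := mul_nonneg hgap hlogζ
      have h4 := mul_nonneg hgap hu0.le
      linarith
    have hsq : (2 * V / w) ^ 2 * (n / c)
        = 4 * (1 / ζ) ^ 2 * (n * Rmax ^ 2 / (c * (1 - γ) ^ 4 * ε ^ 2)) := by
      rw [hw, hRV]
      field_simp
      ring
    set X := n * Rmax ^ 2 / (c * (1 - γ) ^ 4 * ε ^ 2) with hX
    have hX0 : 0 ≤ X := by positivity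
    have hXP : n * Rmax ^ 2 * Real.log (n / δ) / (c * (1 - γ) ^ 4 * ε ^ 2)
        = X * Real.log (n / δ) := by rw [hX]; ring
    rw [hXP] at hTP
    have hfin : (⌈Z⌉₊ : ℝ) * L * L * (3 * L) ^ k ≤ T := by
      calc (⌈Z⌉₊ : ℝ) * L * L * (3 * L) ^ k = ⌈Z⌉₊ * L * (L * (3 * L) ^ k) := by ring
        _ ≤ 2 * Z * (n / c) * y ^ (k + 1) := by gcongr
        _ = 32768 * (1 + Real.log (2 * V / w)) * ((1 / ζ) ^ 2 * y ^ (k + 1)) * (X * p) := by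
            have : 2 * Z * (n / c) = 8192 * (1 + Real.log (2 * V / w)) *
                ((2 * V / w) ^ 2 * (n / c)) * p := by rw [hZ]; ring
            rw [this, hsq]
            ring
        _ ≤ 32768 * ((1 + Real.log (1 / (1 - γ))) * (1 + Real.log (1 / ζ) + u)) *
              ((1 / ζ) ^ 2 * y ^ (k + 1)) * (X * (3 * Real.log (n / δ))) := by
            gcongr
        _ = 98304 * (1 + Real.log (1 / (1 - γ))) * (X * Real.log (n / δ)) *
              ((1 / ζ) ^ 2 * (1 + Real.log (1 / ζ) + u) * y ^ (k + 1)) := by ring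
        _ ≤ 98304 * (1 + Real.log (1 / (1 - γ))) * (X * Real.log (n / δ)) * (20000 * Y) := by
            have : 0 ≤ Real.log (n / δ) := by linarith
            gcongr
        _ ≤ 2 * 10 ^ 9 * (1 + Real.log (1 / (1 - γ))) * (Y * (X * Real.log (n / δ))) := by
            have h0 : 0 ≤ Real.log (n / δ) := by linarith
            have : 0 ≤ (1 + Real.log (1 / (1 - γ))) * (Y * (X * Real.log (n / δ))) := by positivity
            linarith
        _ ≤ T := hTP
    exact_mod_cast hfin.trans ht

/-- The case of a single state-action pair and `δ ≥ 1 / 2`, in which `log (n / δ)` may be arbitrarily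
small. Here every iteration updates the same pair, and the sampling error is that of the reward
alone, hence smaller by the factor `1 - γ`; so the term of the time bound that does not depend on
`δ` is large enough for the failure probability `1 / 2`. -/
theorem le_measure_of_subsingleton [Subsingleton S] [Subsingleton A] (hR : m.RewardBounded Rmax)
    (hγ : 0 < γ) (hγ1 : γ < 1) (hδ : 1 / 2 ≤ δ) (hε : 0 < ε) (hK : 1 ≤ K)
    (h : run.IsReplayQLearning m K M μ ℱ) (hcov : run.Covers K M μ c) {n u T : ℝ}
    (hn : n = Fintype.card S * Fintype.card A) (hL2 : 2 ≤ n / c)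
    (hεD : ε < initDist Rmax γ Q₀) (hu : u = Real.log (initDist Rmax γ Q₀ / ε) / (1 - γ))
    (hTY : 5 * 10 ^ 9 * (3 * (n / c)) ^ max 1 (2 * u) ≤ T) :
    ENNReal.ofReal (1 - δ) ≤
      μ {ω | ∀ t : ℕ, T ≤ t → ‖run.qValue K M γ Q₀ t ω - m.optQ γ‖ ≤ ε} := by
  have h1γ : 0 < 1 - γ := sub_pos.2 hγ1
  have hR0 := MDP.RewardBounded.nonneg hR
  set V := vMax Rmax γ with hVdef
  have hRV : Rmax = (1 - γ) * V := by rw [hVdef, vMax]; field_simp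
  set D := initDist Rmax γ Q₀ with hD
  have hVD : 2 * V ≤ D := by
    have : V ≤ max ‖Q₀‖ V := le_max_right _ _
    rw [hD, initDist]
    linarith
  have hD0 : 0 < D := hε.trans hεD
  have hcov' := ae_exists_visit hcov
  rw [← hn] at hcov'
  set L := ⌊n / c⌋₊ with hL
  have hLle : (L : ℝ) ≤ n / c := Nat.floor_le (by linarith)
  have hL1 : 1 ≤ L := by
    refine Nat.le_floor ?_
    push_cast
    linarith
  set y := 3 * (n / c) with hy
  have hy6 : 6 ≤ y := by linarith
  have hy0 : 0 < y := by linarith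
  have hlogpos : 0 < Real.log (D / ε) := Real.log_pos ((one_lt_div hε).2 hεD)
  have hu0 : 0 < u := hu ▸ div_pos hlogpos h1γ
  have hlogD : Real.log (D / ε) ≤ u := by
    have : Real.log (D / ε) = (1 - γ) * u := by rw [hu]; field_simp
    rw [this]
    nlinarith
  have hDexp : D / ε ≤ Real.exp u := by
    rw [← Real.exp_log (show 0 < D / ε by positivity)]
    exact Real.exp_le_exp.2 hlogD
  have hl8 : Real.log 8 = 3 * Real.log 2 := by
    rw [show (8 : ℝ) = 2 ^ 3 by norm_num, Real.log_pow]
    push_cast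
    ring
  have hl2 := Real.log_two_gt_d9
  have hl2' := Real.log_two_lt_d9
  have hp1 : 1 ≤ Real.log 8 := by linarith
  have hcard : (Fintype.card S : ℝ) * Fintype.card A = 1 := by
    have h1 : Fintype.card S = 1 := Fintype.card_eq_one_iff_nonempty_unique.2
      ⟨⟨⟨Classical.arbitrary S⟩, fun _ => Subsingleton.elim _ _⟩⟩
    have h2 : Fintype.card A = 1 := Fintype.card_eq_one_iff_nonempty_unique.2
      ⟨⟨⟨Classical.arbitrary A⟩, fun _ => Subsingleton.elim _ _⟩⟩
    rw [h1, h2]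
    norm_num
  have hprob : ENNReal.ofReal (1 - δ) ≤ ENNReal.ofReal
      (1 - 4 * ((Fintype.card S : ℝ) * Fintype.card A) * Real.exp (-Real.log 8)) := by
    refine ENNReal.ofReal_le_ofReal ?_
    rw [hcard, Real.exp_neg, Real.exp_log (by norm_num)]
    linarith
  have hcount : ∀ᵐ ω ∂μ, ∀ t x, t / 1 ≤ (run.updates K M t ω x).card := by
    refine Filter.Eventually.of_forall fun ω t x => ?_
    have : run.updates K M t ω x = Finset.range t := by
      ext i
      simp [mem_updates, eq_iff_true_of_subsingleton]
    simp [this]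
  have hσ : ∀ x : S × A, ∀ z : S × ℝ, |z.2| ≤ Rmax →
      |z.2 + γ * (fun s => ⨆ a', m.optQ γ (s, a')) z.1 - m.optQ γ x| ≤ 2 * Rmax := by
    intro x z hz
    have h1 := congrFun (MDP.bellman_optQ (m := m) hR hγ.le hγ1) x
    have h2 : ∑ s', m.transProb x.1 x.2 s' * ⨆ a', m.optQ γ (s', a')
        = ⨆ a', m.optQ γ (z.1, a') := by
      rw [Finset.sum_congr rfl (g := fun s' => m.transProb x.1 x.2 s' *
        ⨆ a', m.optQ γ (z.1, a')) (fun s' _ => by rw [Subsingleton.elim s' z.1]),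
        ← Finset.sum_mul, MDP.sum_transProb, one_mul]
    rw [MDP.bellman, h2] at h1
    have h3 := MDP.abs_meanReward_le hR x.1 x.2
    have h4 : z.2 + γ * (fun s => ⨆ a', m.optQ γ (s, a')) z.1 - m.optQ γ x
        = z.2 - m.meanReward x.1 x.2 := by
      rw [← h1]
      ring
    rw [h4]
    refine (abs_sub _ _).trans ?_
    linarith
  obtain ⟨k, hk, hkY⟩ := exists_phases_of_single hy6 hu0.le
  have hk' : u / (1 - 1 / 100) ≤ 1 + k * (((2 : ℕ) - 1) / (2 : ℕ) : ℝ) := by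
    norm_num at hk ⊢
    exact hk
  set w := (1 - γ) * (1 / 100 * ε) with hw
  have hw0 : 0 < w := by positivity
  set Y := y ^ max 1 (2 * u) with hY
  have hY0 : 0 < Y := by positivity
  rcases le_or_gt (2 * Rmax) w with hsmall | hlarge
  · have hmain := one_sub_le_measure_qValue (Q₀ := Q₀) (p := Real.log 8) (a := 2) (ℓ := 1) (T₁ := 1)
      (n := 0) h hK hR hγ hγ1 (by norm_num) le_rfl hL1 le_rfl hε hεD.le (by norm_num) (by norm_num)
      hu hk' hσ hp1 hcov' hcount (Or.inl hsmall)
    refine hprob.trans (hmain.trans (measure_mono fun ω hω t ht => hω t ?_))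
    have h1 : (2 : ℝ) ^ k ≤ (6 + u) * Real.exp (2 * u) * 2 ^ k * y := by
      have h2 : 1 ≤ Real.exp (2 * u) := Real.one_le_exp (by linarith)
      have h3 : 1 ≤ (6 + u) * Real.exp (2 * u) :=
        one_le_mul_of_one_le_of_one_le (by linarith) h2
      calc (2 : ℝ) ^ k ≤ (6 + u) * Real.exp (2 * u) * 2 ^ k :=
            le_mul_of_one_le_left (by positivity) h3
        _ ≤ _ := le_mul_of_one_le_right (by positivity) (by linarith)
    have h4 : (1 : ℝ) * (2 * 1) ^ k ≤ t := by
      rw [one_mul, mul_one]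
      linarith
    exact_mod_cast h4
  · have hs1 : 1 ≤ 2 * Rmax / w := (one_le_div hw0).2 hlarge.le
    have hls : 0 ≤ Real.log (2 * Rmax / w) := Real.log_nonneg hs1
    set Z := 4096 * (1 + Real.log (2 * Rmax / w)) * (2 * Rmax / w) ^ 2 * Real.log 8 with hZ
    have hZ1 : 1 ≤ Z := by
      have h1 : 1 ≤ (2 * Rmax / w) ^ 2 := one_le_pow₀ hs1
      have h2 : (1 : ℝ) ≤ 4096 * (1 + Real.log (2 * Rmax / w)) := by linarith
      exact one_le_mul_of_one_le_of_one_le (one_le_mul_of_one_le_of_one_le h2 h1) hp1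
    have hN1 : Z ≤ ⌈Z⌉₊ := Nat.le_ceil Z
    have hN2 : (⌈Z⌉₊ : ℝ) ≤ 2 * Z := by
      have := Nat.ceil_lt_add_one (by linarith : 0 ≤ Z)
      linarith
    have hN3 : 1 ≤ ⌈Z⌉₊ := Nat.one_le_ceil_iff.2 (by linarith)
    have hmain := one_sub_le_measure_qValue (Q₀ := Q₀) (p := Real.log 8) (a := 2) (ℓ := 1)
      (T₁ := ⌈Z⌉₊ * L * 1) (n := ⌈Z⌉₊) h hK hR hγ hγ1 (by norm_num) le_rfl hL1
      (Nat.mul_pos (Nat.mul_pos hN3 hL1) one_pos) hε hεD.le (by norm_num) (by norm_num)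
      hu hk' hσ hp1 hcov' hcount (Or.inr ⟨hlarge.le, hN1, le_rfl⟩)
    refine hprob.trans (hmain.trans (measure_mono fun ω hω t ht => hω t ?_))
    have hratio : 2 * Rmax / w ≤ 100 * (D / ε) := by
      have h1 : 2 * Rmax / w = 100 * (2 * V / ε) := by
        rw [hw, hRV]
        field_simp
      rw [h1]
      gcongr
    have hlog100 : Real.log 100 ≤ 5 := by
      have h1 := Real.log_le_sub_one_of_pos (show (0 : ℝ) < 100 / 2 ^ 6 by norm_num)
      rw [Real.log_div (by norm_num) (by norm_num), Real.log_pow] at h1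
      push_cast at h1
      linarith
    have hlog : 1 + Real.log (2 * Rmax / w) ≤ 6 + u := by
      have h1 := Real.log_le_log (by linarith) hratio
      rw [Real.log_mul (by norm_num) (by positivity)] at h1
      linarith
    have hsq : (2 * Rmax / w) ^ 2 ≤ 10000 * Real.exp (2 * u) := by
      calc (2 * Rmax / w) ^ 2 ≤ (100 * Real.exp u) ^ 2 := by
            gcongr
            exact hratio.trans (by gcongr)
        _ = 10000 * Real.exp (2 * u) := by
            rw [mul_pow, ← Real.exp_nat_mul]
            norm_num
    have hLy : (L : ℝ) ≤ y / 3 := by rw [hy]; linarith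
    have hfin : (⌈Z⌉₊ : ℝ) * L * 1 * (2 * 1) ^ k ≤ T := by
      calc (⌈Z⌉₊ : ℝ) * L * 1 * (2 * 1) ^ k = ⌈Z⌉₊ * L * 2 ^ k := by ring
        _ ≤ 2 * (4096 * (6 + u) * (10000 * Real.exp (2 * u)) * (21 / 10)) * (y / 3) * 2 ^ k := by
            gcongr
            refine hN2.trans ?_
            rw [hZ]
            gcongr
            linarith
        _ = 8192 * 7000 * ((6 + u) * Real.exp (2 * u) * 2 ^ k * y) := by ring
        _ ≤ 8192 * 7000 * (60 * Y) := by gcongr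
        _ ≤ 5 * 10 ^ 9 * Y := by linarith
        _ ≤ T := hTY
    exact_mod_cast hfin.trans ht

/-- The error bound from any time on that exceeds the explicit quantity by the constant factor
`10 ^ 10`, up to the hidden logarithms. -/
theorem le_measure_norm_qValue_sub_le (hR : m.RewardBounded Rmax) (hγ : 0 < γ) (hγ1 : γ < 1)
    (hc : 0 < c) (hc1 : c < 1) (hδ : 0 < δ) (hδ1 : δ < 1) (hε : 0 < ε) (hK : 1 ≤ K) (hM : 1 ≤ M)
    (h : run.IsReplayQLearning m K M μ ℱ) (hcov : run.Covers K M μ c) {T : ℝ}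
    (hT : 10 ^ 10 * softFactor γ (initDist Rmax γ Q₀) ε *
      timeBound (Fintype.card S * Fintype.card A) Rmax γ (initDist Rmax γ Q₀) c δ ε ≤ T) :
    ENNReal.ofReal (1 - δ) ≤
      μ {ω | ∀ t : ℕ, T ≤ t → ‖run.qValue K M γ Q₀ t ω - m.optQ γ‖ ≤ ε} := by
  set D := initDist Rmax γ Q₀ with hD
  rcases le_or_gt D ε with hDε | hDε
  · refine one_sub_le_measure_of_ae (N := ∅) hδ.le (by simp) ?_
    filter_upwards [ae_norm_qValue_sub_le_initDist (Q₀ := Q₀) h hK hR hγ hγ1] with ω hω _ t _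
    exact (hω t).trans hDε
  have h1γ : 0 < 1 - γ := sub_pos.2 hγ1
  set n : ℝ := Fintype.card S * Fintype.card A with hn
  have hn1 : 1 ≤ n := by
    have h1 : (1 : ℝ) ≤ Fintype.card S := by exact_mod_cast Fintype.card_pos
    have h2 : (1 : ℝ) ≤ Fintype.card A := by exact_mod_cast Fintype.card_pos
    rw [hn]
    nlinarith
  have hn0 : 0 < n := by linarith
  have hL2 : 2 ≤ n / c := two_le_of_covers hK hM hcov
  have hgap : 0 ≤ Real.log (1 / (1 - γ)) :=
    Real.log_nonneg ((one_le_div h1γ).2 (by linarith))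
  have hsoft := one_add_log_le_softFactor γ D ε
  set s := softFactor γ D ε with hs
  have hs1 : 1 ≤ s := by linarith
  set u := Real.log (D / ε) / (1 - γ) with hu
  set Y := (3 * (n / c)) ^ max 1 (2 * u) with hY
  have hY0 : 0 < Y := by positivity
  have hnδ : 1 < n / δ := by rw [one_lt_div hδ]; linarith
  set P := n * Rmax ^ 2 * Real.log (n / δ) / (c * (1 - γ) ^ 4 * ε ^ 2) with hP
  have hP0 : 0 ≤ P := by
    have := Real.log_pos hnδ
    positivity
  have hB : 1 / 2 ≤ Real.log (n / c ^ 3) := by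
    have h1 : 2 ≤ n / c ^ 3 := by
      refine hL2.trans ?_
      gcongr
      exact pow_le_of_le_one hc.le hc1.le (by norm_num)
    have := Real.log_le_log (by norm_num) h1
    linarith [Real.log_two_gt_d9]
  have htb : timeBound n Rmax γ D c δ ε = Y * (P + Real.log (n / c ^ 3)) := by
    have h1 : 3 * n / c = 3 * (n / c) := by ring
    have h2 : 2 / (1 - γ) * Real.log (D / ε) = 2 * u := by rw [hu]; ring
    rw [timeBound, hY, hP, h1, h2]
  rw [htb] at hT
  have hTY : 5 * 10 ^ 9 * Y ≤ T := by
    refine le_trans ?_ hT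
    have h1 : Y * (1 / 2) ≤ Y * (P + Real.log (n / c ^ 3)) := by gcongr; linarith
    have h2 : 1 * (Y * (1 / 2)) ≤ s * (Y * (P + Real.log (n / c ^ 3))) :=
      mul_le_mul hs1 h1 (by positivity) (by linarith)
    linarith
  rcases le_or_gt 2 (n / δ) with h2 | h2
  · refine le_measure_of_two_le_div hR hγ hγ1 hδ hε hK h hcov hn hn0 hc hL2 h2 hDε hu
      (by linarith) (le_trans ?_ hT)
    have h3 : Y * P ≤ Y * (P + Real.log (n / c ^ 3)) := by gcongr; linarith
    have h4 : (1 + Real.log (1 / (1 - γ))) * (Y * P) ≤ s * (Y * (P + Real.log (n / c ^ 3))) :=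
      mul_le_mul hsoft h3 (by positivity) (by linarith)
    have h5 : 0 ≤ (1 + Real.log (1 / (1 - γ))) * (Y * P) := by positivity
    linarith
  · have hn2 : n < 2 := by
      rw [div_lt_iff₀ hδ] at h2
      linarith
    have hprod : Fintype.card S * Fintype.card A < 2 := by
      have : ((Fintype.card S * Fintype.card A : ℕ) : ℝ) < (2 : ℕ) := by push_cast; exact hn2
      exact_mod_cast this
    have hS : Fintype.card S ≤ 1 := by
      have := Fintype.card_pos (α := A)
      nlinarith
    have hA : Fintype.card A ≤ 1 := by
      have := Fintype.card_pos (α := S)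
      nlinarith
    have := Fintype.card_le_one_iff_subsingleton.1 hS
    have := Fintype.card_le_one_iff_subsingleton.1 hA
    have hδ2 : 1 / 2 ≤ δ := by
      rw [div_lt_iff₀ hδ] at h2
      linarith
    exact le_measure_of_subsingleton hR hγ hγ1 hδ2 hε hK h hcov hn hL2 hDε hu hTY

end Bounds

end Run

end ReplayQ

theorem corollary1 :
    ∃ C : ℝ, 0 < C ∧ ∃ d : ℕ,
      ∀ (S A Ω : Type*) [Fintype S] [Nonempty S] [MeasurableSpace S] [DiscreteMeasurableSpace S]
        [Fintype A] [Nonempty A] [MeasurableSpace A] [DiscreteMeasurableSpace A]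
        (mΩ : MeasurableSpace Ω) (μ : Measure Ω) [IsProbabilityMeasure μ] (ℱ : Filtration ℕ mΩ)
        (m : ReplayQ.MDP S A) (Rmax γ c δ ε₁ : ℝ) (K M : ℕ) (Q₀ : S × A → ℝ)
        (run : ReplayQ.Run S A Ω),
        m.RewardBounded Rmax →
        0 < γ → γ < 1 →
        0 < c → c < 1 →
        0 < δ → δ < 1 →
        0 < ε₁ →
        1 ≤ K → 1 ≤ M →
        run.IsReplayQLearning m K M μ ℱ →
        run.Covers K M μ c →
        ∀ T : ℝ,
          C * ReplayQ.softFactor γ (ReplayQ.initDist Rmax γ Q₀) ε₁ ^ d *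
              ReplayQ.timeBound (Fintype.card S * Fintype.card A) Rmax γ
                (ReplayQ.initDist Rmax γ Q₀) c δ ε₁ ≤ T →
          ENNReal.ofReal (1 - δ) ≤
            μ {ω | ∀ t : ℕ, T ≤ t → ‖run.qValue K M γ Q₀ t ω - m.optQ γ‖ ≤ ε₁} := by
  refine ⟨10 ^ 10, by positivity, 1, ?_⟩
  intro S A Ω _ _ _ _ _ _ _ _ mΩ μ _ ℱ m Rmax γ c δ ε₁ K M Q₀ run hR hγ hγ1 hc hc1 hδ hδ1 hε hK hM
    h hcov T hT
  rw [pow_one] at hT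
  exact run.le_measure_norm_qValue_sub_le hR hγ hγ1 hc hc1 hδ hδ1 hε hK hM h hcov hT
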